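/- Let $G=\mathrm{SL}_3(\mathbb R)$, $K=\mathrm{SO}(3)$, and let $X=G/K$ be the Riemannian symmetric space with base point $o=[K]$ and with the distance $d$ of the $G$-invariant Riemannian metric induced by the Killing form $B(x,y)=6\,\mathrm{Tr}(xy)$. Let $H$ be the identity component of $\mathrm{SO}(F)=\{g\in G: F\circ g=F\}$ for $F(x,y,z)=2xz-y^2$, and let $Y=Ho\subset X$, a totally geodesic plane. For $s,t\in\mathbb R$ put $$h_s=\mathrm{diag}(e^s,1,e^{-s}),\qquad a_t=\mathrm{diag}(e^t,e^{-2t},e^t),\qquad k_0=\begin{pmatrix}\frac12&\frac1{\sqrt2}&\frac12\\-\frac1{\sqrt2}&0&\frac1{\sqrt2}\\\frac12&-\frac1{\sqrt2}&\frac12\end{pmatrix},$$ and $A_0=\{h_s:s\in\mathbb R\}$. For a complete geodesic $L=hA_0o$ of $Y$ $(h\in H)$ let $Y_{L,t}=h\,a_tY$ be the floating plane over $L$; let $\gamma_t(s)=a_tk_0h_so$, which is a point of $Y_t:=a_tY=Y_{A_0o,t}$. For every $x\in X$ there is a unique point $\pi(x)\in Y$ with $d(x,\pi(x))=\inf_{y\in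 Y}d(x,y)$, and the nearest point projection $\pi:X\to Y$ so defined has the following properties. 1. For every complete geodesic $L=hA_0o$ of $Y$ (in particular for $L=A_0o$, $Y_{L,t}=Y_t$) and every $\varepsilon>0$, the union $\bigcup_{|t|>\varepsilon}\pi(Y_{L,t})$ lies within a bounded distance from $L$. 2. Let $(t_n)$, $(s_n)$ be sequences of real numbers. If $(t_n)$ is bounded and there is $\varepsilon>0$ with $|t_n|>\varepsilon$ for all $n$, then the sequence $\pi(\gamma_{t_n}(s_n))$ is bounded. If $(s_n)$ is bounded, then the sequence $\pi(\gamma_{t_n}(s_n))$ is bounded. -/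

import Mathlib

noncomputable section

namespace FloatingPlanes

/-- `G = SL₃(ℝ)`, with Mathlib's topology and group structure. -/
abbrev G : Type := Matrix.SpecialLinearGroup (Fin 3) ℝ

/-- `K = SO(3) = {g ∈ G : (gᵀ)⁻¹ = g}`. -/
def K : Subgroup G where
  carrier := {g | (g : Matrix (Fin 3) (Fin 3) ℝ) ∈ Matrix.orthogonalGroup (Fin 3) ℝ}
  mul_mem' {a b} ha hb := by
    simpa only [Set.mem_ofPred_eq, Matrix.SpecialLinearGroup.coe_mul] using mul_mem ha hb
  one_mem' := by
    simpa only [Set.mem_ofPred_eq, Matrix.SpecialLinearGroup.coe_one] using one_mem _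
  inv_mem' {g} hg := by
    have h1 : (g : Matrix (Fin 3) (Fin 3) ℝ) * star (g : Matrix (Fin 3) (Fin 3) ℝ) = 1 :=
      (Matrix.mem_orthogonalGroup_iff (Fin 3) ℝ).1 hg
    have h2 : ((g⁻¹ : G) : Matrix (Fin 3) (Fin 3) ℝ) * (g : Matrix (Fin 3) (Fin 3) ℝ) = 1 := by
      rw [← Matrix.SpecialLinearGroup.coe_mul, inv_mul_cancel, Matrix.SpecialLinearGroup.coe_one]
    have h3 : ((g⁻¹ : G) : Matrix (Fin 3) (Fin 3) ℝ) = star (g : Matrix (Fin 3) (Fin 3) ℝ) :=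
      left_inv_eq_right_inv h2 h1
    simpa only [Set.mem_ofPred_eq, h3] using Unitary.star_mem hg

/-- The symmetric space `X = G/K`. -/
abbrev X : Type := G ⧸ K

/-- The base point `o = [K]`. -/
def o : X := QuotientGroup.mk (1 : G)

/-- The Killing form `B(x, y) = 6 Tr(xy)` of `𝔰𝔩₃(ℝ)`. -/
def killing (x y : Matrix (Fin 3) (Fin 3) ℝ) : ℝ := 6 * (x * y).trace

/-- A `C¹` curve in `G` (its matrix entries are `C¹` functions). -/
def IsC1Curve (c : ℝ → G) : Prop :=
  ∀ i j, ContDiff ℝ 1 (fun τ => (c τ : Matrix (Fin 3) (Fin 3) ℝ) i j)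

/-- The left-translated velocity `c(τ)⁻¹ c'(τ) ∈ 𝔤` of a curve in `G`. -/
def velocity (c : ℝ → G) (τ : ℝ) : Matrix (Fin 3) (Fin 3) ℝ :=
  (((c τ)⁻¹ : G) : Matrix (Fin 3) (Fin 3) ℝ) *
    Matrix.of (fun i j => deriv (fun u => (c u : Matrix (Fin 3) (Fin 3) ℝ) i j) τ)

/-- The component of `x ∈ 𝔤 = 𝔨 ⊕ 𝔭` in `𝔭`, the symmetric matrices; `𝔭` is the tangent space
of `X` at `o`, and the projection is the differential of `G → X` at the identity. -/
def pPart (x : Matrix (Fin 3) (Fin 3) ℝ) : Matrix (Fin 3) (Fin 3) ℝ :=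
  (1 / 2 : ℝ) • (x + x.transpose)

/-- The Riemannian length of the curve `τ ↦ c(τ) o`, `0 ≤ τ ≤ 1`, in `X`, for the `G`-invariant
Riemannian metric which is the Killing form on `T_o X = 𝔭`. -/
def curveLength (c : ℝ → G) : ℝ :=
  ∫ τ in (0 : ℝ)..1, Real.sqrt (killing (pPart (velocity c τ)) (pPart (velocity c τ)))

/-- The Riemannian distance on `X`: the infimum of the lengths of `C¹` curves in `X` from `x`
to `y`. A `C¹` curve in `X` is the image of a `C¹` curve in `G`. -/
def dX (x y : X) : ℝ :=
  sInf {ℓ : ℝ | ∃ c : ℝ → G, IsC1Curve c ∧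
    (QuotientGroup.mk (c 0) : X) = x ∧ (QuotientGroup.mk (c 1) : X) = y ∧ curveLength c = ℓ}

/-- The quadratic form `F(x, y, z) = 2xz - y²`. -/
def F (v : Fin 3 → ℝ) : ℝ := 2 * v 0 * v 2 - v 1 ^ 2

/-- `SO(F)`, the subgroup of `G` preserving `F`. -/
def SOF : Subgroup G where
  carrier := {g | ∀ v : Fin 3 → ℝ, F ((g : Matrix (Fin 3) (Fin 3) ℝ).mulVec v) = F v}
  mul_mem' {a b} ha hb v := by
    rw [Matrix.SpecialLinearGroup.coe_mul, ← Matrix.mulVec_mulVec, ha, hb]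
  one_mem' v := by
    rw [Matrix.SpecialLinearGroup.coe_one, Matrix.one_mulVec]
  inv_mem' {g} hg v := by
    have h : (g : Matrix (Fin 3) (Fin 3) ℝ).mulVec
        (((g⁻¹ : G) : Matrix (Fin 3) (Fin 3) ℝ).mulVec v) = v := by
      rw [Matrix.mulVec_mulVec, ← Matrix.SpecialLinearGroup.coe_mul, mul_inv_cancel,
        Matrix.SpecialLinearGroup.coe_one, Matrix.one_mulVec]
    rw [← hg, h]

/-- `H`, the identity component of `SO(F)`. -/
def H : Subgroup G := (Subgroup.connectedComponentOfOne SOF).map SOF.subtype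

/-- The totally geodesic plane `Y = H o`. -/
def Y : Set X := {x | ∃ h ∈ H, x = h • o}

/-- `h_s = diag(eˢ, 1, e⁻ˢ)`; these elements form the group `A₀`. -/
def hDiag (s : ℝ) : G :=
  ⟨Matrix.diagonal ![Real.exp s, 1, Real.exp (-s)], by
    simp [Matrix.det_diagonal, Fin.prod_univ_three, ← Real.exp_add]⟩

/-- `a_t = diag(eᵗ, e⁻²ᵗ, eᵗ)`. -/
def aDiag (t : ℝ) : G :=
  ⟨Matrix.diagonal ![Real.exp t, Real.exp (-2 * t), Real.exp t], by
    simp only [Matrix.det_diagonal, Fin.prod_univ_three, Matrix.cons_val, ← Real.exp_add]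
    rw [← Real.exp_zero]
    congr 1
    ring⟩

/-- The quarter turn `k₀ ∈ H ∩ K`. -/
def k₀ : G :=
  ⟨!![1 / 2, 1 / Real.sqrt 2, 1 / 2;
      -(1 / Real.sqrt 2), 0, 1 / Real.sqrt 2;
      1 / 2, -(1 / Real.sqrt 2), 1 / 2], by
    have h : (1 / Real.sqrt 2) * (1 / Real.sqrt 2) = 1 / 2 := by
      rw [div_mul_div_comm, Real.mul_self_sqrt (by norm_num)]; norm_num
    rw [Matrix.det_fin_three]
    simp only [Matrix.of_apply, Matrix.cons_val]
    linear_combination 2 * h⟩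

/-- The complete geodesic `h A₀ o`. For `h ∈ H` these are the complete geodesics of `Y`. -/
def geodesic (h : G) : Set X := {x | ∃ s : ℝ, x = h • hDiag s • o}

/-- The floating plane `Y_{L,t} = h a_t Y` over the geodesic `L = h A₀ o`. -/
def floatingPlane (h : G) (t : ℝ) : Set X := {x | ∃ y ∈ Y, x = h • aDiag t • y}

/-- The point `γ_t(s) = a_t k₀ h_s o` of `Y_t = a_t Y`. -/
def γ (t s : ℝ) : X := aDiag t • k₀ • hDiag s • o

/-- `π` is the nearest point projection `X → Y`: for every `x`, the point `π x` of `Y` is the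
unique point of `Y` at minimal distance from `x`. This determines `π`. -/
def IsNearestPointProjection (π : X → X) : Prop :=
  ∀ x, π x ∈ Y ∧ ∀ y ∈ Y, y ≠ π x → dX x (π x) < dX x y

end FloatingPlanes

end

/-!
Under `g o ↦ g gᵀ` the space `X` becomes the set of positive definite matrices of determinant one.
Nonpositive curvature enters as the fact that the matrix logarithm does not decrease distances
(`sqrt_trace_log_sub_log_le_integral`), while it preserves distances from the base point. Hence,
if the geodesic from `h o ∈ Y` to `x` is orthogonal to `Y`, then Pythagoras in the tangent space at
`h o` makes `h o` the unique nearest point of `Y`. With `J` the matrix of `F`, translating by `h⁻¹`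
turns orthogonality into commutation of `J` with a positive definite matrix.

For `g = h⁻¹ aₜ k` with `h`, `k` in `SO(F)`, the matrix `N = g J gᵀ` is `e²ᵗ J` plus the rank one
term `(e²ᵗ - e⁻⁴ᵗ) w wᵀ`, where `w` is the middle column of `h⁻¹`, and `N (g gᵀ)⁻¹ N = g gᵀ`. If
`g gᵀ` commutes with `J`, comparing the two eigenspaces of `J` bounds `w ⬝ w = (h hᵀ)₁₁` in terms
of `|t|`, and this entry controls the distance from `h o` to `A₀ o`. Finally, the foot of the
perpendicular from `γₜ(s)` is `k₀ h_r o` with `tanh 2r = tanh 2s / cosh 3t`.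
-/

noncomputable section

open Matrix NormedSpace Filter
open scoped Topology Matrix.Norms.L2Operator MatrixOrder

namespace FloatingPlanes

section PosDef

variable {n : Type*} [Fintype n] [DecidableEq n]

theorem trace_mul_self_eq_sum {n : Type*} [Fintype n] {A : Matrix n n ℝ} (hA : A.IsHermitian) :
    (A * A).trace = ∑ i, ∑ j, A i j ^ 2 := by
  simp only [trace, diag_apply, mul_apply, sq]
  exact Finset.sum_congr rfl fun i _ => Finset.sum_congr rfl fun j _ => by
    rw [← hA.apply i j, star_trivial]

theorem trace_cfc {A : Matrix n n ℝ} (hA : A.IsHermitian) (f : ℝ → ℝ) :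
    (cfc f A).trace = ∑ i, f (hA.eigenvalues i) := by
  rw [hA.cfc_eq, IsHermitian.cfc, Unitary.conjStarAlgAut_apply, trace_mul_cycle,
    Unitary.coe_star_mul_self, one_mul, trace_diagonal]
  rfl

theorem exists_trace_cfc_mul_cfc_eq_sum {A B : Matrix n n ℝ} (hA : A.IsHermitian)
    (hB : B.IsHermitian) : ∃ w : n → n → ℝ, (∀ i j, 0 ≤ w i j) ∧ ∀ f g : ℝ → ℝ,
      (cfc f A * cfc g B).trace =
        ∑ i, ∑ j, w i j * (f (hA.eigenvalues i) * g (hB.eigenvalues j)) := by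
  let W : Matrix n n ℝ := star hA.eigenvectorUnitary.1 * hB.eigenvectorUnitary.1
  refine ⟨fun i j => W i j ^ 2, fun i j => sq_nonneg _, fun f g => ?_⟩
  calc (cfc f A * cfc g B).trace
      = (diagonal (f ∘ hA.eigenvalues) * W * (diagonal (g ∘ hB.eigenvalues) * star W)).trace := by
        rw [hA.cfc_eq, hB.cfc_eq, IsHermitian.cfc, IsHermitian.cfc, Unitary.conjStarAlgAut_apply,
          Unitary.conjStarAlgAut_apply, star_mul, star_star]
        simp only [mul_assoc]
        rw [trace_mul_comm]
        simp only [W, mul_assoc]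
        rfl
    _ = _ := by
        simp only [trace, diag_apply, Matrix.mul_apply (M := diagonal _ * _),
          diagonal_mul, star_apply, star_trivial, Function.comp_apply]
        exact Finset.sum_congr rfl fun i _ => Finset.sum_congr rfl fun j _ => by ring

theorem cfc_mul_self (f : ℝ → ℝ) (A : Matrix n n ℝ) :
    cfc f A * cfc f A = cfc (fun x => f x * f x) A :=
  have hf : ContinuousOn f (spectrum ℝ A) := A.finite_real_spectrum.continuousOn f
  (cfc_mul f f A hf hf).symm

theorem inv_eq_cfc {P : Matrix n n ℝ} (hP : P.PosDef) : P⁻¹ = cfc (fun x : ℝ => x⁻¹) P :=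
  (nonsing_inv_eq_ringInverse P).trans (cfc_ringInverse_id P hP.isUnit hP.isHermitian).symm

theorem log_sub_log_sq_le {x y : ℝ} (hx : 0 < x) (hy : 0 < y) :
    (Real.log x - Real.log y) ^ 2 ≤ x * y⁻¹ + x⁻¹ * y - 2 := by
  rw [← Real.log_div hx.ne' hy.ne']
  obtain ⟨z, hz⟩ : ∃ z, Real.exp (2 * z) = x / y :=
    ⟨Real.log (x / y) / 2, by rw [mul_div_cancel₀ _ two_ne_zero, Real.exp_log (by positivity)]⟩
  have h_cosh : x * y⁻¹ + x⁻¹ * y = 2 * Real.cosh (2 * z) := by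
    rw [Real.cosh_eq, Real.exp_neg, hz]
    field_simp
  have h_sinh : z ^ 2 ≤ Real.sinh z ^ 2 := by
    rw [sq_le_sq, Real.abs_sinh]
    exact Real.self_le_sinh_iff.2 (abs_nonneg z)
  rw [h_cosh, ← hz, Real.log_exp, Real.cosh_two_mul, Real.cosh_sq]
  linarith

theorem trace_log_sub_log_mul_self_le {P Q : Matrix n n ℝ} (hP : P.PosDef) (hQ : Q.PosDef) :
    ((CFC.log P - CFC.log Q) * (CFC.log P - CFC.log Q)).trace ≤
      (P * Q⁻¹).trace + (P⁻¹ * Q).trace - 2 * Fintype.card n := by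
  obtain ⟨w, hw, h⟩ := exists_trace_cfc_mul_cfc_eq_sum hP.isHermitian hQ.isHermitian
  have hP1 : cfc (1 : ℝ → ℝ) P = 1 := cfc_one ℝ P hP.isHermitian
  have hQ1 : cfc (1 : ℝ → ℝ) Q = 1 := cfc_one ℝ Q hQ.isHermitian
  have hPid : cfc (id : ℝ → ℝ) P = P := cfc_id ℝ P hP.isHermitian
  have hQid : cfc (id : ℝ → ℝ) Q = Q := cfc_id ℝ Q hQ.isHermitian
  have h_one := h 1 1
  have h_mul_inv := h id (fun y => y⁻¹)
  have h_inv_mul := h (fun x => x⁻¹) id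
  have h_log_log := h Real.log Real.log
  have h_log_sq_left := h (fun x => Real.log x * Real.log x) 1
  have h_log_sq_right := h 1 (fun x => Real.log x * Real.log x)
  rw [hP1, hQ1, one_mul, trace_one] at h_one
  rw [hPid, ← inv_eq_cfc hQ] at h_mul_inv
  rw [hQid, ← inv_eq_cfc hP] at h_inv_mul
  rw [hQ1, ← cfc_mul_self, mul_one] at h_log_sq_left
  rw [hP1, ← cfc_mul_self, one_mul] at h_log_sq_right
  rw [CFC.log, CFC.log, sub_mul, mul_sub, mul_sub, trace_sub, trace_sub, trace_sub,
    trace_mul_comm (cfc Real.log Q) (cfc Real.log P), h_one, h_mul_inv, h_inv_mul, h_log_log,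
    h_log_sq_left, h_log_sq_right]
  simp only [Finset.mul_sum, ← Finset.sum_add_distrib, ← Finset.sum_sub_distrib]
  refine Finset.sum_le_sum fun i _ => Finset.sum_le_sum fun j _ => ?_
  have := mul_le_mul_of_nonneg_left
    (log_sub_log_sq_le (hP.eigenvalues_pos i) (hQ.eigenvalues_pos j)) (hw i j)
  simp only [id, Pi.one_apply]
  linarith

theorem trace_log {P : Matrix n n ℝ} (hP : P.PosDef) : (CFC.log P).trace = Real.log P.det := by
  rw [CFC.log, trace_cfc hP.isHermitian, hP.isHermitian.det_eq_prod_eigenvalues]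
  exact (Real.log_prod fun i _ => (hP.eigenvalues_pos i).ne').symm

theorem posDef_exp {A : Matrix n n ℝ} (hA : A.IsHermitian) : (exp A).PosDef :=
  (nonneg_iff_posSemidef.1 (IsSelfAdjoint.exp_nonneg hA)).posDef_iff_isUnit.2 (Matrix.isUnit_exp A)

theorem det_exp {A : Matrix n n ℝ} (hA : A.IsHermitian) : (exp A).det = Real.exp A.trace := by
  rw [← CFC.log_exp A hA, trace_log (posDef_exp hA), Real.exp_log (posDef_exp hA).det_pos,
    CFC.log_exp A hA]

theorem trace_mul_sq_le {m : Type*} [Fintype m] {A B : Matrix m m ℝ} (hA : A.IsHermitian)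
    (hB : B.IsHermitian) : (A * B).trace ^ 2 ≤ (A * A).trace * (B * B).trace := by
  have hAB : (A * B).trace = ∑ i, ∑ j, A i j * B i j := by
    simp only [trace, diag_apply, Matrix.mul_apply]
    exact Finset.sum_congr rfl fun i _ => Finset.sum_congr rfl fun j _ => by
      rw [← hB.apply i j, star_trivial]
  rw [hAB, trace_mul_self_eq_sum hA, trace_mul_self_eq_sum hB]
  simp only [← Finset.sum_product']
  exact Finset.sum_mul_sq_le_sq_mul_sq _ _ _

theorem trace_inv_mul_sub_mul_inv_mul_sub {P Q : Matrix n n ℝ} (hP : IsUnit P) (hQ : IsUnit Q) :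
    (P⁻¹ * (Q - P) * (Q⁻¹ * (Q - P))).trace =
      (P * Q⁻¹).trace + (P⁻¹ * Q).trace - 2 * Fintype.card n := by
  have hPP : P⁻¹ * P = 1 := nonsing_inv_mul P ((isUnit_iff_isUnit_det P).1 hP)
  have hQQ : Q⁻¹ * Q = 1 := nonsing_inv_mul Q ((isUnit_iff_isUnit_det Q).1 hQ)
  have hQQ' : Q * Q⁻¹ = 1 := mul_nonsing_inv Q ((isUnit_iff_isUnit_det Q).1 hQ)
  have expand : P⁻¹ * (Q - P) * (Q⁻¹ * (Q - P)) = P⁻¹ * Q + Q⁻¹ * P - 2 • 1 := by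
    rw [mul_sub, mul_sub, hPP, hQQ, sub_mul, one_mul, mul_sub, mul_one, mul_assoc P⁻¹,
      ← mul_assoc Q, hQQ', one_mul, hPP]
    abel
  rw [expand, trace_sub, trace_add, trace_smul, trace_one, trace_mul_comm Q⁻¹, two_nsmul]
  ring

theorem trace_mul_log_sub_log_le {D P Q : Matrix n n ℝ} (hD : D.IsHermitian) (hP : P.PosDef)
    (hQ : Q.PosDef) : (D * (CFC.log Q - CFC.log P)).trace ≤
      √(D * D).trace * √(P⁻¹ * (Q - P) * (Q⁻¹ * (Q - P))).trace := by
  have h_log : (CFC.log P - CFC.log Q).IsHermitian := IsSelfAdjoint.log.sub IsSelfAdjoint.log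
  have h_sq := trace_mul_sq_le hD h_log
  have h_le := trace_log_sub_log_mul_self_le hP hQ
  have h_nonneg : 0 ≤ (D * D).trace := by
    rw [trace_mul_self_eq_sum hD]
    positivity
  rw [← trace_inv_mul_sub_mul_inv_mul_sub hP.isUnit hQ.isUnit] at h_le
  rw [← Real.sqrt_mul h_nonneg]
  refine Real.le_sqrt_of_sq_le (le_trans (le_of_eq ?_)
    (h_sq.trans (mul_le_mul_of_nonneg_left h_le h_nonneg)))
  rw [← neg_sub, mul_neg, trace_neg, neg_sq]

theorem continuousAt_inv_of_isUnit {A : Matrix n n ℝ} (hA : IsUnit A) :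
    ContinuousAt (fun B : Matrix n n ℝ => B⁻¹) A :=
  continuousAt_matrix_inv A
    (NormedRing.inverse_continuousAt ((isUnit_iff_isUnit_det A).1 hA).unit)

theorem eventually_slope_trace_mul_log_lt {D : Matrix n n ℝ} (hD : D.IsHermitian)
    {P : ℝ → Matrix n n ℝ} {P' : Matrix n n ℝ} {x r : ℝ} (hpos : ∀ t, (P t).PosDef)
    (hderiv : HasDerivAt P P' x)
    (hr : √(D * D).trace * √((P x)⁻¹ * P' * ((P x)⁻¹ * P')).trace < r) :
    ∀ᶠ z in 𝓝[>] x, slope (fun t => (D * CFC.log (P t)).trace) x z < r := by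
  have h_slope : Tendsto (slope P x) (𝓝[>] x) (𝓝 P') :=
    hderiv.tendsto_slope.mono_left (nhdsWithin_mono _ fun _ hz => ne_of_gt hz)
  have h_inv : Tendsto (fun z => (P z)⁻¹) (𝓝[>] x) (𝓝 (P x)⁻¹) :=
    ((continuousAt_inv_of_isUnit (hpos x).isUnit).comp hderiv.continuousAt).mono_left
      nhdsWithin_le_nhds
  have h_speed : Tendsto (fun z => √(D * D).trace *
      √((P x)⁻¹ * slope P x z * ((P z)⁻¹ * slope P x z)).trace) (𝓝[>] x)
      (𝓝 (√(D * D).trace * √((P x)⁻¹ * P' * ((P x)⁻¹ * P')).trace)) :=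
    tendsto_const_nhds.mul ((Real.continuous_sqrt.tendsto _).comp
      (((continuous_id.matrix_trace).tendsto _).comp
        ((tendsto_const_nhds.mul h_slope).mul (h_inv.mul h_slope))))
  filter_upwards [h_speed.eventually_lt_const hr, self_mem_nhdsWithin] with z hz hxz
  have hxz' : 0 < z - x := sub_pos.2 hxz
  refine lt_of_le_of_lt ?_ hz
  have h_le := trace_mul_log_sub_log_le hD (hpos x) (hpos z)
  rw [mul_sub, trace_sub] at h_le
  have h_scale : √((P x)⁻¹ * slope P x z * ((P z)⁻¹ * slope P x z)).trace =
      √((P x)⁻¹ * (P z - P x) * ((P z)⁻¹ * (P z - P x))).trace / (z - x) := by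
    rw [slope_def_module]
    simp only [Matrix.mul_smul, Matrix.smul_mul, smul_smul, trace_smul, smul_eq_mul]
    rw [Real.sqrt_mul (mul_self_nonneg _), Real.sqrt_mul_self (inv_nonneg.2 hxz'.le),
      div_eq_inv_mul]
  rw [slope_def_field, h_scale, ← mul_div_assoc]
  gcongr

theorem sqrt_trace_log_sub_log_le_integral {P P' : ℝ → Matrix n n ℝ} (hpos : ∀ t, (P t).PosDef)
    (hderiv : ∀ t, HasDerivAt P (P' t) t) (hcont : Continuous P') {a b : ℝ} (hab : a ≤ b) :
    √((CFC.log (P b) - CFC.log (P a)) * (CFC.log (P b) - CFC.log (P a))).trace ≤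
      ∫ t in a..b, √((P t)⁻¹ * P' t * ((P t)⁻¹ * P' t)).trace := by
  have hP : Continuous P := continuous_iff_continuousAt.2 fun t => (hderiv t).continuousAt
  have hPinv : Continuous fun t => (P t)⁻¹ := continuous_iff_continuousAt.2 fun t =>
    (continuousAt_inv_of_isUnit (hpos t).isUnit).comp hP.continuousAt
  have h_log : Continuous fun t => CFC.log (P t) :=
    (CFC.continuousOn_log (A := Matrix n n ℝ)).comp_continuous hP fun t =>
      ⟨(hpos t).isHermitian, (hpos t).isUnit⟩
  set D := CFC.log (P b) - CFC.log (P a)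
  have hD : D.IsHermitian := IsSelfAdjoint.log.sub IsSelfAdjoint.log
  set speed : ℝ → ℝ := fun t => √((P t)⁻¹ * P' t * ((P t)⁻¹ * P' t)).trace
  have h_speed : Continuous speed :=
    (((hPinv.matrix_mul hcont).matrix_mul (hPinv.matrix_mul hcont)).matrix_trace).sqrt
  have h_bound := image_le_of_liminf_slope_right_le_deriv_boundary
    (f := fun t => (D * CFC.log (P t)).trace - (D * CFC.log (P a)).trace)
    (B := fun t => √(D * D).trace * ∫ u in a..t, speed u)
    (B' := fun t => √(D * D).trace * speed t) (a := a) (b := b)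
    (((continuous_const.matrix_mul h_log).matrix_trace.sub continuous_const).continuousOn)
    (by simp)
    ((continuous_const.mul (intervalIntegral.continuous_primitive
      (fun _ _ => h_speed.intervalIntegrable _ _) a)).continuousOn)
    (fun x _ => ((h_speed.integral_hasStrictDerivAt a x).hasDerivAt.const_mul _).hasDerivWithinAt)
    (fun x _ r hr => by
      refine (eventually_slope_trace_mul_log_lt hD hpos (hderiv x) hr).frequently.mono ?_
      simp only [slope_def_field, sub_sub_sub_cancel_right, imp_self, implies_true])
    (Set.right_mem_Icc.2 hab)
  simp only [← trace_sub, ← mul_sub] at h_bound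
  rcases (Real.sqrt_nonneg (D * D).trace).eq_or_lt with h0 | h0
  · rw [← h0]
    exact intervalIntegral.integral_nonneg hab fun _ _ => Real.sqrt_nonneg _
  · refine le_of_mul_le_mul_left (le_trans (le_of_eq ?_) h_bound) h0
    exact Real.mul_self_sqrt (Real.sqrt_pos.1 h0).le

theorem trace_inv_mul_conj_mul_self {C : Matrix n n ℝ} (hC : IsUnit C) (W : Matrix n n ℝ) :
    ((C * Cᵀ)⁻¹ * (C * W * Cᵀ) * ((C * Cᵀ)⁻¹ * (C * W * Cᵀ))).trace = (W * W).trace := by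
  have hC' : IsUnit C.det := (isUnit_iff_isUnit_det C).1 hC
  have hCt : IsUnit Cᵀ.det := by rwa [det_transpose]
  have h_conj : (C * Cᵀ)⁻¹ * (C * W * Cᵀ) = Cᵀ⁻¹ * W * Cᵀ := by
    rw [Matrix.mul_inv_rev, mul_assoc, mul_assoc, nonsing_inv_mul_cancel_left _ _ hC', mul_assoc]
  have h_sq : Cᵀ⁻¹ * W * Cᵀ * (Cᵀ⁻¹ * W * Cᵀ) = Cᵀ⁻¹ * (W * W) * Cᵀ := by
    simp only [mul_assoc, mul_nonsing_inv_cancel_left _ _ hCt]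
  rw [h_conj, h_sq, trace_conj' ((isUnit_iff_isUnit_det _).2 hCt)]

theorem posDef_conj {R P : Matrix n n ℝ} (hR : R.IsHermitian) (hR_unit : IsUnit R)
    (hP : P.PosDef) : (R * P * R).PosDef := by
  have := hP.conjTranspose_mul_mul_same (mulVec_injective_of_isUnit hR_unit)
  rwa [hR.eq] at this

theorem posDef_sqrt {P : Matrix n n ℝ} (hP : P.PosDef) : (CFC.sqrt P).PosDef :=
  isStrictlyPositive_iff_posDef.1 hP.isStrictlyPositive.sqrt

theorem exists_posDef_mul_mul_eq {n : Type*} [Fintype n] {M P : Matrix n n ℝ} (hM : M.PosDef)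
    (hP : P.PosDef) : ∃ S : Matrix n n ℝ, S.PosDef ∧ S * M * S = P := by
  classical
  set R := CFC.sqrt M
  have hR : R.PosDef := posDef_sqrt hM
  have hRR : R * R = M := CFC.sqrt_mul_sqrt_self M hM.posSemidef.nonneg
  have hRi : R * R⁻¹ = 1 := mul_nonsing_inv R ((isUnit_iff_isUnit_det R).1 hR.isUnit)
  have hiR : R⁻¹ * R = 1 := nonsing_inv_mul R ((isUnit_iff_isUnit_det R).1 hR.isUnit)
  have hRPR : (R * P * R).PosDef := posDef_conj hR.isHermitian hR.isUnit hP
  set T := CFC.sqrt (R * P * R)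
  have hTT : T * T = R * P * R := CFC.sqrt_mul_sqrt_self _ hRPR.posSemidef.nonneg
  refine ⟨R⁻¹ * T * R⁻¹, posDef_conj hR.inv.isHermitian hR.inv.isUnit (posDef_sqrt hRPR), ?_⟩
  calc R⁻¹ * T * R⁻¹ * M * (R⁻¹ * T * R⁻¹)
      = R⁻¹ * T * (R⁻¹ * R) * (R * R⁻¹) * T * R⁻¹ := by rw [← hRR]; simp only [mul_assoc]
    _ = R⁻¹ * (T * T) * R⁻¹ := by simp only [hRi, hiR, mul_assoc, one_mul]
    _ = (R⁻¹ * R) * P * (R * R⁻¹) := by rw [hTT]; simp only [mul_assoc]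
    _ = P := by rw [hRi, hiR, one_mul, mul_one]

theorem eq_of_posDef_mul_mul_eq {n : Type*} [Fintype n] {M S T : Matrix n n ℝ} (hM : M.PosDef)
    (hS : S.PosDef) (hT : T.PosDef) (h : S * M * S = T * M * T) : S = T := by
  classical
  set R := CFC.sqrt M
  have hR : R.PosDef := posDef_sqrt hM
  have hRR : R * R = M := CFC.sqrt_mul_sqrt_self M hM.posSemidef.nonneg
  have h_sq (A : Matrix n n ℝ) : R * A * R * (R * A * R) = R * (A * M * A) * R := by
    rw [← hRR]
    simp only [mul_assoc]
  have h_conj : R * S * R = R * T * R :=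
    (CFC.mul_self_eq_mul_self_iff _ _
      (posDef_conj hR.isHermitian hR.isUnit hS).posSemidef.nonneg
      (posDef_conj hR.isHermitian hR.isUnit hT).posSemidef.nonneg).1 (by rw [h_sq, h_sq, h])
  exact hR.isUnit.mul_left_cancel (hR.isUnit.mul_right_cancel h_conj)

theorem mul_mul_eq_of_mul_conj_mul_eq {J P S : Matrix n n ℝ} (hJ : J.IsHermitian)
    (hJJ : J * J = 1) (hP : P.PosDef) (hS : S.PosDef) (h : S * (J * P * J) * S = P) :
    S * J * S = J := by
  have hJ_unit : IsUnit J := IsUnit.of_mul_eq_one J hJJ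
  have hS_det : IsUnit S.det := (isUnit_iff_isUnit_det S).1 hS.isUnit
  have hJ_left (A : Matrix n n ℝ) : J * (J * A) = A := by rw [← mul_assoc, hJJ, one_mul]
  have h_inv : S⁻¹ * P * S⁻¹ = J * P * J := by
    nth_rw 1 [← h]
    simp only [mul_assoc, mul_nonsing_inv S hS_det, mul_one,
      nonsing_inv_mul_cancel_left S _ hS_det]
  have hS_eq : S = J * S⁻¹ * J := by
    refine eq_of_posDef_mul_mul_eq (posDef_conj hJ hJ_unit hP) hS
      (posDef_conj hJ hJ_unit hS.inv) (h.trans ?_)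
    calc P = J * (J * P * J) * J := by simp only [mul_assoc, hJ_left, hJJ, mul_one]
      _ = J * (S⁻¹ * P * S⁻¹) * J := by rw [h_inv]
      _ = J * S⁻¹ * J * (J * P * J) * (J * S⁻¹ * J) := by simp only [mul_assoc, hJ_left]
  calc S * J * S = S * J * (J * S⁻¹ * J) := by rw [← hS_eq]
    _ = J := by simp only [mul_assoc, hJ_left, mul_nonsing_inv_cancel_left S _ hS_det]

theorem log_conj {J P : Matrix n n ℝ} (hJ : J.IsHermitian) (hJJ : J * J = 1) (hP : P.PosDef) :
    CFC.log (J * P * J) = J * CFC.log P * J := by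
  have h_exp : exp (J * CFC.log P * J) = J * P * J := by
    simpa [CFC.exp_log P hP.isStrictlyPositive] using
      Matrix.exp_units_conj ⟨J, J, hJJ, hJJ⟩ (CFC.log P)
  have h_log : (J * CFC.log P * J).IsHermitian := by
    have := isHermitian_conjTranspose_mul_mul J (IsSelfAdjoint.log (a := P)).isHermitian
    rwa [hJ.eq] at this
  rw [← h_exp, CFC.log_exp (J * CFC.log P * J) h_log]

theorem log_inv {P : Matrix n n ℝ} (hP : P.PosDef) : CFC.log P⁻¹ = -CFC.log P := by
  rw [← CFC.log_exp (-CFC.log P) IsSelfAdjoint.log.neg, Matrix.exp_neg,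
    CFC.exp_log P hP.isStrictlyPositive]

theorem conj_log_eq_neg {J S : Matrix n n ℝ} (hJ : J.IsHermitian) (hJJ : J * J = 1)
    (hS : S.PosDef) (h : S * J * S = J) : J * CFC.log S * J = -CFC.log S := by
  have h_inv : J * S * J = S⁻¹ := by
    refine (inv_eq_left_inv ?_).symm
    rw [mul_assoc, mul_assoc, ← mul_assoc S, h, hJJ]
  rw [← log_conj hJ hJJ hS, h_inv, log_inv hS]

theorem eq_of_forall_dotProduct_mulVec_self_eq {n : Type*} [Fintype n] {A B : Matrix n n ℝ}
    (hA : A.IsSymm) (hB : B.IsSymm) (h : ∀ v, v ⬝ᵥ A *ᵥ v = v ⬝ᵥ B *ᵥ v) : A = B := by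
  classical
  ext i j
  have h_add := h (Pi.single i 1 + Pi.single j 1)
  have h_left := h (Pi.single i 1)
  have h_right := h (Pi.single j 1)
  simp only [mulVec_add, add_dotProduct, dotProduct_add, single_one_dotProduct,
    mulVec_single_one, col_apply] at h_add h_left h_right
  linarith [hA.apply i j, hB.apply i j]

theorem trace_mul_eq_zero_of_conj {n : Type*} [Fintype n] {J A B : Matrix n n ℝ}
    (hA : J * A * J = A) (hB : J * B * J = -B) : (A * B).trace = 0 := by
  have h : (A * B).trace = -(A * B).trace := by
    calc (A * B).trace = (J * A * J * B).trace := by rw [hA]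
      _ = (A * (J * B * J)).trace := by
        rw [mul_assoc, mul_assoc, trace_mul_comm]
        simp only [mul_assoc]
      _ = -(A * B).trace := by rw [hB, mul_neg, trace_neg]
  linarith

theorem dotProduct_mulVec_eq_zero_of_commute {n : Type*} [Fintype n] {J R : Matrix n n ℝ}
    (hJ : J.IsHermitian) (hJR : Commute J R) {u v : n → ℝ} (hu : J *ᵥ u = u) (hv : J *ᵥ v = -v) :
    u ⬝ᵥ R *ᵥ v = 0 := by
  have h : u ⬝ᵥ R *ᵥ v = -(u ⬝ᵥ R *ᵥ v) := by
    calc u ⬝ᵥ R *ᵥ v = J *ᵥ u ⬝ᵥ R *ᵥ v := by rw [hu]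
      _ = u ⬝ᵥ (J * R) *ᵥ v := by
        nth_rw 1 [← hJ.eq, conjTranspose_eq_transpose_of_trivial, mulVec_transpose,
          ← dotProduct_mulVec, mulVec_mulVec]
      _ = -(u ⬝ᵥ R *ᵥ v) := by
        rw [hJR.eq, ← mulVec_mulVec, hv, mulVec_neg, dotProduct_neg]
  linarith

theorem eigenvector_relation_of_mul_inv_mul_eq {J Q N : Matrix n n ℝ} (hJ : J.IsHermitian)
    (hQ : Q.PosDef) (hJQ : Commute J Q) {u v : n → ℝ} (hu : J *ᵥ u = u) (hv : J *ᵥ v = -v)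
    {E κ : ℝ} (hN : N = E • J + κ • vecMulVec (u + v) (u + v)) (hNQ : N * Q⁻¹ * N = Q) :
    κ * ((E + κ * (u ⬝ᵥ u)) * (v ⬝ᵥ v) * (u ⬝ᵥ Q⁻¹ *ᵥ u) +
      (u ⬝ᵥ u) * (κ * (v ⬝ᵥ v) - E) * (v ⬝ᵥ Q⁻¹ *ᵥ v)) = 0 := by
  have hJQ_inv : Commute J Q⁻¹ := by
    simpa only [Matrix.zpow_neg_one] using Matrix.Commute.zpow_right hJQ (-1)
  have huv : u ⬝ᵥ v = 0 := by
    simpa only [one_mulVec] using dotProduct_mulVec_eq_zero_of_commute hJ (.one_right J) hu hv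
  have huDv : u ⬝ᵥ Q⁻¹ *ᵥ v = 0 := dotProduct_mulVec_eq_zero_of_commute hJ hJQ_inv hu hv
  have hvDu : v ⬝ᵥ Q⁻¹ *ᵥ u = 0 := by
    rw [← huDv, ← dotProduct_transpose_mulVec, ← conjTranspose_eq_transpose_of_trivial,
      hQ.inv.isHermitian.eq]
  have hN_mulVec (w : n → ℝ) : N *ᵥ w = E • J *ᵥ w + (κ * ((u + v) ⬝ᵥ w)) • (u + v) := by
    rw [hN, add_mulVec, smul_mulVec, smul_mulVec, vecMulVec_mulVec, op_smul_eq_smul, smul_smul]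
  have hNu : N *ᵥ u = (E + κ * (u ⬝ᵥ u)) • u + (κ * (u ⬝ᵥ u)) • v := by
    rw [hN_mulVec, hu, add_dotProduct, dotProduct_comm v, huv, add_zero]
    module
  have hNv : N *ᵥ v = (κ * (v ⬝ᵥ v)) • u + (κ * (v ⬝ᵥ v) - E) • v := by
    rw [hN_mulVec, hv, add_dotProduct, huv, zero_add]
    module
  have hN_symm : Nᵀ = N := by
    rw [hN, transpose_add, transpose_smul, transpose_smul, transpose_vecMulVec,
      ← conjTranspose_eq_transpose_of_trivial J, hJ.eq]
  have h_eq : N *ᵥ u ⬝ᵥ Q⁻¹ *ᵥ N *ᵥ v = 0 := by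
    rw [← dotProduct_mulVec_eq_zero_of_commute hJ hJQ hu hv, ← hNQ, ← mulVec_mulVec,
      ← mulVec_mulVec, dotProduct_mulVec u, ← mulVec_transpose, hN_symm, hNQ]
  rw [hNu, hNv] at h_eq
  simp only [mulVec_add, mulVec_smul, add_dotProduct, dotProduct_add, smul_dotProduct,
    dotProduct_smul, huDv, hvDu, smul_eq_mul] at h_eq
  linear_combination h_eq

theorem sub_mul_mem_Icc_of_mul_eq_mul {E W a d m : ℝ} (hE : 0 < E) (hW : 0 < W)
    (hd : 0 < d) (hm : 0 < m) (h : (E + (E - W) * a) * d = (W - (E - W) * a) * m) :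
    (E - W) * a ∈ Set.Icc (-E) W := by
  constructor
  · by_contra! h_neg
    linarith [mul_neg_of_neg_of_pos (by linarith : E + (E - W) * a < 0) hd,
      mul_pos (by linarith : 0 < W - (E - W) * a) hm]
  · by_contra! h_neg
    linarith [mul_neg_of_neg_of_pos (by linarith : W - (E - W) * a < 0) hm,
      mul_pos (by linarith : 0 < E + (E - W) * a) hd]

theorem sub_mul_dotProduct_mem_Icc {J Q N : Matrix n n ℝ} (hJ : J.IsHermitian)
    (hQ : Q.PosDef) (hJQ : Commute J Q) {u v : n → ℝ} (hu : J *ᵥ u = u) (hv : J *ᵥ v = -v)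
    (huv : v ⬝ᵥ v = u ⬝ᵥ u + 1) {E W : ℝ} (hE : 0 < E) (hW : 0 < W)
    (hN : N = E • J + (E - W) • vecMulVec (u + v) (u + v)) (hNQ : N * Q⁻¹ * N = Q) :
    (E - W) * (u ⬝ᵥ u) ∈ Set.Icc (-E) W := by
  have h := eigenvector_relation_of_mul_inv_mul_eq hJ hQ hJQ hu hv hN hNQ
  have h_nonneg : 0 ≤ u ⬝ᵥ u := dotProduct_self_star_nonneg u
  rcases eq_or_ne ((E - W) * (u ⬝ᵥ u)) 0 with h_zero | h_ne
  · rw [h_zero]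
    exact ⟨by linarith, hW.le⟩
  have h_pos : 0 < u ⬝ᵥ u := h_nonneg.lt_of_ne' (right_ne_zero_of_mul h_ne)
  have hu_ne : u ≠ 0 := fun hu => by simp [hu] at h_pos
  have hv_ne : v ≠ 0 := fun hv => by
    rw [hv, dotProduct_zero] at huv
    linarith
  have hd : 0 < u ⬝ᵥ Q⁻¹ *ᵥ u := hQ.inv.dotProduct_mulVec_pos hu_ne
  have hm : 0 < v ⬝ᵥ Q⁻¹ *ᵥ v := hQ.inv.dotProduct_mulVec_pos hv_ne
  have h_cancel := (mul_eq_zero.1 h).resolve_left (left_ne_zero_of_mul h_ne)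
  rw [huv] at h_cancel
  refine sub_mul_mem_Icc_of_mul_eq_mul hE hW
    (mul_pos (by linarith : 0 < u ⬝ᵥ u + 1) hd) (mul_pos h_pos hm) ?_
  linear_combination h_cancel

theorem sub_mul_half_dotProduct_sub_one_mem_Icc {J Q N : Matrix n n ℝ} (hJ : J.IsHermitian)
    (hJJ : J * J = 1) (hQ : Q.PosDef) (hJQ : Commute J Q) {w : n → ℝ} (hw : w ⬝ᵥ J *ᵥ w = -1)
    {E W : ℝ} (hE : 0 < E) (hW : 0 < W) (hN : N = E • J + (E - W) • vecMulVec w w)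
    (hNQ : N * Q⁻¹ * N = Q) : (E - W) * ((w ⬝ᵥ w - 1) / 2) ∈ Set.Icc (-E) W := by
  have hJw : J *ᵥ J *ᵥ w = w := by rw [mulVec_mulVec, hJJ, one_mulVec]
  have hJw_sq : J *ᵥ w ⬝ᵥ J *ᵥ w = w ⬝ᵥ w := by
    rw [← dotProduct_transpose_mulVec, ← conjTranspose_eq_transpose_of_trivial, hJ.eq, hJw]
  have hw_comm : J *ᵥ w ⬝ᵥ w = -1 := by rw [dotProduct_comm, hw]
  set u := (1 / 2 : ℝ) • (w + J *ᵥ w) with hu_def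
  set v := (1 / 2 : ℝ) • (w - J *ᵥ w) with hv_def
  have hu : J *ᵥ u = u := by rw [hu_def, mulVec_smul, mulVec_add, hJw, add_comm]
  have hv : J *ᵥ v = -v := by
    rw [hv_def, mulVec_smul, mulVec_sub, hJw, ← smul_neg, neg_sub]
  have h_add : u + v = w := by rw [hu_def, hv_def]; module
  have hu_sq : u ⬝ᵥ u = (w ⬝ᵥ w - 1) / 2 := by
    simp only [hu_def, smul_dotProduct, dotProduct_smul, add_dotProduct, dotProduct_add, hw,
      hJw_sq, hw_comm, smul_eq_mul]
    ring
  have hv_sq : v ⬝ᵥ v = u ⬝ᵥ u + 1 := by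
    rw [hu_sq]
    simp only [hv_def, smul_dotProduct, dotProduct_smul, sub_dotProduct, dotProduct_sub, hw,
      hJw_sq, hw_comm, smul_eq_mul]
    ring
  rw [← hu_sq]
  exact sub_mul_dotProduct_mem_Icc hJ hQ hJQ hu hv hv_sq hE hW (by rw [h_add, hN]) hNQ

end PosDef

local notation "M₃" => Matrix (Fin 3) (Fin 3) ℝ

/-! ### Matrix model and distance -/

theorem coe_mul_coe_inv (g : G) : (g : M₃) * ((g⁻¹ : G) : M₃) = 1 := by
  rw [← Matrix.SpecialLinearGroup.coe_mul, mul_inv_cancel, Matrix.SpecialLinearGroup.coe_one]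

theorem coe_inv_mul_coe (g : G) : ((g⁻¹ : G) : M₃) * (g : M₃) = 1 :=
  mul_eq_one_comm.1 (coe_mul_coe_inv g)

theorem isUnit_coe (g : G) : IsUnit (g : M₃) := IsUnit.of_mul_eq_one _ (coe_mul_coe_inv g)

theorem exists_smul_o_eq (x : X) : ∃ g : G, g • o = x := MulAction.exists_smul_eq G o x

/-- The positive definite matrix `g gᵀ`. It depends only on the point `g o`, and embeds `X` into
the positive definite matrices of determinant one. -/
def gram (g : G) : M₃ := (g : M₃) * (g : M₃)ᵀ

theorem gram_one : gram 1 = 1 := by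
  rw [gram, Matrix.SpecialLinearGroup.coe_one, transpose_one, mul_one]

theorem gram_mul (g h : G) : gram (g * h) = (g : M₃) * gram h * (g : M₃)ᵀ := by
  simp only [gram, Matrix.SpecialLinearGroup.coe_mul, transpose_mul, mul_assoc]

theorem posDef_gram (g : G) : (gram g).PosDef :=
  PosDef.mul_conjTranspose_self _ (vecMul_injective_of_isUnit (isUnit_coe g))

theorem det_gram (g : G) : (gram g).det = 1 := by
  rw [gram, det_mul, det_transpose, g.det_coe, mul_one]

theorem smul_o_eq_mk (g : G) : g • o = QuotientGroup.mk g := congrArg _ (mul_one g)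

theorem smul_o_eq_smul_o_iff {g h : G} : g • o = h • o ↔ gram g = gram h := by
  have mem_K_iff : g⁻¹ * h ∈ K ↔ gram (g⁻¹ * h) = 1 := mem_orthogonalGroup_iff (Fin 3) ℝ
  rw [smul_o_eq_mk, smul_o_eq_mk, QuotientGroup.eq, mem_K_iff]
  constructor <;> intro h_eq
  · rw [← mul_inv_cancel_left g h, gram_mul, h_eq, mul_one, gram]
  · rw [gram_mul, ← h_eq, ← gram_mul, inv_mul_cancel, gram_one]

/-- The symmetric matrix `A` of trace zero for which `g o = exp(A) o`: the preimage of `g o`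
under the Riemannian exponential map at `o`. -/
def polarLog (g : G) : M₃ := (1 / 2 : ℝ) • CFC.log (gram g)

theorem isHermitian_polarLog (g : G) : (polarLog g).IsHermitian :=
  (IsSelfAdjoint.all (1 / 2 : ℝ)).smul (IsSelfAdjoint.log (a := gram g))

theorem trace_polarLog (g : G) : (polarLog g).trace = 0 := by
  rw [polarLog, trace_smul, trace_log (posDef_gram g), det_gram, Real.log_one, smul_zero]

theorem two_smul_polarLog (g : G) : (2 : ℝ) • polarLog g = CFC.log (gram g) := by
  rw [polarLog, smul_smul, mul_one_div_cancel two_ne_zero, one_smul]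

theorem exp_two_smul_polarLog (g : G) : exp ((2 : ℝ) • polarLog g) = gram g := by
  rw [two_smul_polarLog, CFC.exp_log _ (posDef_gram g).isStrictlyPositive]

theorem killing_self_nonneg {A : M₃} (hA : A.IsHermitian) : 0 ≤ killing A A := by
  rw [killing, trace_mul_self_eq_sum hA]
  positivity

theorem killing_self_pos {A : M₃} (hA : A.IsHermitian) (hA_ne : A ≠ 0) : 0 < killing A A := by
  refine (killing_self_nonneg hA).lt_of_ne' (mul_ne_zero (by norm_num) fun h => hA_ne ?_)
  rwa [← trace_conjTranspose_mul_self_eq_zero_iff, hA.eq]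

theorem killing_polarLog_le (g : G) :
    killing (polarLog g) (polarLog g) ≤ 3 / 2 * ((gram g).trace + (gram g)⁻¹.trace - 6) := by
  have h := trace_log_sub_log_mul_self_le (posDef_gram g) PosDef.one
  rw [CFC.log_one, sub_zero, inv_one, mul_one, mul_one, Fintype.card_fin] at h
  rw [killing, polarLog, smul_mul_smul_comm, trace_smul, smul_eq_mul]
  push_cast at h
  linarith

section Curves

variable {c : ℝ → G}

theorem velocity_eq_of_hasDerivAt {V : M₃} {τ : ℝ}
    (h : HasDerivAt (fun u => (c u : M₃)) ((c τ : M₃) * V) τ) :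
    velocity c τ = V := by
  have h_deriv : Matrix.of (fun i j => deriv (fun u => (c u : M₃) i j) τ) = (c τ : M₃) * V := by
    ext i j
    exact (hasDerivAt_pi.1 (hasDerivAt_pi.1 h i) j).deriv
  rw [velocity, h_deriv, ← mul_assoc, coe_inv_mul_coe, one_mul]

theorem isC1Curve_of_hasDerivAt {V : ℝ → M₃} (hV : Continuous V)
    (h : ∀ τ, HasDerivAt (fun u => (c u : M₃)) (V τ) τ) : IsC1Curve c := fun i j => by
  have h_entry (τ : ℝ) : HasDerivAt (fun u => (c u : M₃) i j) (V τ i j) τ :=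
    hasDerivAt_pi.1 (hasDerivAt_pi.1 (h τ) i) j
  rw [contDiff_one_iff_deriv, funext fun τ => (h_entry τ).deriv]
  exact ⟨fun τ => (h_entry τ).differentiableAt, hV.matrix_elem i j⟩

theorem IsC1Curve.hasDerivAt (hc : IsC1Curve c) (τ : ℝ) :
    HasDerivAt (fun u => (c u : M₃)) ((c τ : M₃) * velocity c τ) τ := by
  rw [velocity, ← mul_assoc, coe_mul_coe_inv, one_mul]
  exact hasDerivAt_pi.2 fun i => hasDerivAt_pi.2 fun j =>
    ((hc i j).differentiable one_ne_zero τ).hasDerivAt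

theorem IsC1Curve.continuous_coe (hc : IsC1Curve c) : Continuous fun τ => (c τ : M₃) :=
  continuous_iff_continuousAt.2 fun τ => (hc.hasDerivAt τ).continuousAt

theorem IsC1Curve.continuous_velocity (hc : IsC1Curve c) : Continuous (velocity c) := by
  have h_inv : Continuous fun τ => (((c τ)⁻¹ : G) : M₃) := by
    simp only [Matrix.SpecialLinearGroup.coe_inv]
    exact hc.continuous_coe.matrix_adjugate
  exact h_inv.matrix_mul <| continuous_matrix fun i j => (hc i j).continuous_deriv le_rfl

theorem IsC1Curve.mul_left (hc : IsC1Curve c) (g : G) : IsC1Curve fun τ => g * c τ :=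
  isC1Curve_of_hasDerivAt
    (continuous_const.matrix_mul (hc.continuous_coe.matrix_mul hc.continuous_velocity))
    fun τ => (hc.hasDerivAt τ).const_mul (g : M₃)

theorem IsC1Curve.velocity_mul_left (hc : IsC1Curve c) (g : G) (τ : ℝ) :
    velocity (fun τ => g * c τ) τ = velocity c τ := by
  refine velocity_eq_of_hasDerivAt ?_
  rw [Matrix.SpecialLinearGroup.coe_mul, mul_assoc]
  exact (hc.hasDerivAt τ).const_mul (g : M₃)

theorem IsC1Curve.reverse (hc : IsC1Curve c) : IsC1Curve fun τ => c (1 - τ) := fun i j =>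
  (hc i j).comp (contDiff_const.sub contDiff_id)

theorem IsC1Curve.velocity_reverse (hc : IsC1Curve c) (τ : ℝ) :
    velocity (fun τ => c (1 - τ)) τ = -velocity c (1 - τ) := by
  refine velocity_eq_of_hasDerivAt ?_
  rw [mul_neg]
  exact (hc.hasDerivAt (1 - τ)).comp_const_sub 1 τ

theorem IsC1Curve.hasDerivAt_gram (hc : IsC1Curve c) (τ : ℝ) :
    HasDerivAt (fun u => gram (c u))
      ((c τ : M₃) * ((2 : ℝ) • pPart (velocity c τ)) * (c τ : M₃)ᵀ) τ := by
  refine ((hc.hasDerivAt τ).mul (hc.hasDerivAt τ).star).congr_deriv ?_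
  rw [pPart, smul_smul, mul_one_div_cancel two_ne_zero, one_smul, mul_add, add_mul,
    star_eq_conjTranspose, star_eq_conjTranspose, conjTranspose_eq_transpose_of_trivial,
    conjTranspose_eq_transpose_of_trivial, transpose_mul]
  simp only [mul_assoc]

theorem curveLength_nonneg (c : ℝ → G) : 0 ≤ curveLength c :=
  intervalIntegral.integral_nonneg zero_le_one fun _ _ => Real.sqrt_nonneg _

theorem dX_le_curveLength (hc : IsC1Curve c) : dX (c 0 • o) (c 1 • o) ≤ curveLength c := by
  refine csInf_le ⟨0, ?_⟩ ⟨c, hc, (smul_o_eq_mk _).symm, (smul_o_eq_mk _).symm, rfl⟩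
  rintro _ ⟨c, -, -, -, rfl⟩
  exact curveLength_nonneg c

theorem sqrt_killing_polarLog_sub_le_curveLength (hc : IsC1Curve c) :
    √(killing (polarLog (c 1) - polarLog (c 0)) (polarLog (c 1) - polarLog (c 0))) ≤
      curveLength c := by
  have h_pPart : Continuous fun τ => pPart (velocity c τ) :=
    (hc.continuous_velocity.add hc.continuous_velocity.matrix_transpose).const_smul (1 / 2 : ℝ)
  have h_deriv : Continuous fun τ =>
      (c τ : M₃) * ((2 : ℝ) • pPart (velocity c τ)) * (c τ : M₃)ᵀ :=
    (hc.continuous_coe.matrix_mul (h_pPart.const_smul (2 : ℝ))).matrix_mul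
      hc.continuous_coe.matrix_transpose
  have h := sqrt_trace_log_sub_log_le_integral (fun τ => posDef_gram (c τ)) hc.hasDerivAt_gram
    h_deriv zero_le_one
  have h_killing (A : M₃) :
      √(killing A A) = √(3 / 2) * √(((2 : ℝ) • A) * ((2 : ℝ) • A)).trace := by
    rw [← Real.sqrt_mul (by norm_num), killing, smul_mul_smul_comm, trace_smul, smul_eq_mul]
    ring_nf
  simp only [← two_smul_polarLog, ← smul_sub] at h
  simp only [gram, trace_inv_mul_conj_mul_self (isUnit_coe _)] at h
  simp only [curveLength, h_killing, intervalIntegral.integral_const_mul]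
  exact mul_le_mul_of_nonneg_left h (Real.sqrt_nonneg _)

end Curves

/-- The one-parameter group `τ ↦ exp (τ A)` of transvections along the geodesic through `o` with
tangent vector `A ∈ 𝔭`. -/
def expG (A : M₃) (hA : A.IsHermitian) (hA_trace : A.trace = 0) (τ : ℝ) : G :=
  ⟨exp (τ • A), by
    rw [det_exp (hA.smul (IsSelfAdjoint.all τ)), trace_smul, hA_trace, smul_zero, Real.exp_zero]⟩

section ExpG

variable {A : M₃} (hA : A.IsHermitian) (hA_trace : A.trace = 0)

theorem coe_expG (τ : ℝ) : (expG A hA hA_trace τ : M₃) = exp (τ • A) := rfl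

theorem hasDerivAt_coe_expG (τ : ℝ) :
    HasDerivAt (fun τ => (expG A hA hA_trace τ : M₃)) ((expG A hA hA_trace τ : M₃) * A) τ :=
  hasDerivAt_exp_smul_const A τ

theorem isC1Curve_expG : IsC1Curve (expG A hA hA_trace) := by
  refine isC1Curve_of_hasDerivAt (Continuous.matrix_mul ?_ continuous_const)
    (hasDerivAt_coe_expG hA hA_trace)
  exact continuous_iff_continuousAt.2 fun τ => (hasDerivAt_coe_expG hA hA_trace τ).continuousAt

theorem curveLength_expG : curveLength (expG A hA hA_trace) = √(killing A A) := by
  have h_pPart (τ : ℝ) : pPart (velocity (expG A hA hA_trace) τ) = A := by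
    rw [velocity_eq_of_hasDerivAt (hasDerivAt_coe_expG hA hA_trace τ), pPart,
      ← conjTranspose_eq_transpose_of_trivial, hA.eq, ← two_smul ℝ A, smul_smul,
      one_div_mul_cancel two_ne_zero, one_smul]
  simp only [curveLength, h_pPart, intervalIntegral.integral_const, sub_zero, one_smul]

theorem expG_zero : expG A hA hA_trace 0 = 1 :=
  Subtype.ext <| by rw [coe_expG, zero_smul, exp_zero, Matrix.SpecialLinearGroup.coe_one]

theorem gram_expG (τ : ℝ) : gram (expG A hA hA_trace τ) = exp ((2 * τ) • A) := by
  rw [gram, coe_expG, ← conjTranspose_eq_transpose_of_trivial, ← exp_conjTranspose,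
    (hA.smul (IsSelfAdjoint.all τ)).eq, mul_smul, two_smul ℝ,
    Matrix.exp_add_of_commute _ _ (Commute.refl (τ • A))]

end ExpG

theorem expG_polarLog_smul_o (g : G) :
    expG (polarLog g) (isHermitian_polarLog g) (trace_polarLog g) 1 • o = g • o := by
  rw [smul_o_eq_smul_o_iff, gram_expG, mul_one, exp_two_smul_polarLog]

theorem exists_isC1Curve (g h : G) :
    ∃ c, IsC1Curve c ∧ c 0 • o = g • o ∧ c 1 • o = h • o := by
  refine ⟨_, (isC1Curve_expG (isHermitian_polarLog (g⁻¹ * h)) (trace_polarLog _)).mul_left g,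
    ?_, ?_⟩
  · rw [expG_zero, mul_one]
  · rw [mul_smul, expG_polarLog_smul_o, ← mul_smul, mul_inv_cancel_left]

theorem le_dX {g h : G} {r : ℝ}
    (hr : ∀ c, IsC1Curve c → c 0 • o = g • o → c 1 • o = h • o → r ≤ curveLength c) :
    r ≤ dX (g • o) (h • o) := by
  obtain ⟨c, hc, hc₀, hc₁⟩ := exists_isC1Curve g h
  simp only [smul_o_eq_mk] at *
  refine le_csInf ⟨_, c, hc, hc₀, hc₁, rfl⟩ ?_
  rintro _ ⟨c, hc, hc₀, hc₁, rfl⟩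
  exact hr c hc hc₀ hc₁

theorem sqrt_killing_polarLog_sub_le_dX (g h : G) :
    √(killing (polarLog h - polarLog g) (polarLog h - polarLog g)) ≤ dX (g • o) (h • o) := by
  refine le_dX fun c hc hc₀ hc₁ => ?_
  have h_polarLog {g h : G} (h_eq : g • o = h • o) : polarLog g = polarLog h := by
    rw [polarLog, polarLog, smul_o_eq_smul_o_iff.1 h_eq]
  rw [← h_polarLog hc₀, ← h_polarLog hc₁]
  exact sqrt_killing_polarLog_sub_le_curveLength hc

theorem dX_o_smul_o_le (g : G) : dX o (g • o) ≤ √(killing (polarLog g) (polarLog g)) := by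
  have h := dX_le_curveLength (isC1Curve_expG (isHermitian_polarLog g) (trace_polarLog g))
  rwa [expG_zero, one_smul, expG_polarLog_smul_o, curveLength_expG] at h

theorem dX_o_smul_o_le_sqrt_trace (g : G) :
    dX o (g • o) ≤ √(3 / 2 * ((gram g).trace + (gram g)⁻¹.trace - 6)) :=
  (dX_o_smul_o_le g).trans (Real.sqrt_le_sqrt (killing_polarLog_le g))

theorem dX_smul_smul_le (g : G) (x y : X) : dX (g • x) (g • y) ≤ dX x y := by
  obtain ⟨a, rfl⟩ := exists_smul_o_eq x
  obtain ⟨b, rfl⟩ := exists_smul_o_eq y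
  refine le_dX fun c hc hc₀ hc₁ => ?_
  have h_length : curveLength (fun τ => g * c τ) = curveLength c := by
    simp only [curveLength, hc.velocity_mul_left]
  rw [← hc₀, ← hc₁, ← h_length]
  simpa only [mul_smul] using dX_le_curveLength (hc.mul_left g)

theorem dX_smul_smul (g : G) (x y : X) : dX (g • x) (g • y) = dX x y :=
  (dX_smul_smul_le g x y).antisymm <| by simpa using dX_smul_smul_le g⁻¹ (g • x) (g • y)

theorem dX_smul_o_smul_o (g h : G) : dX (g • o) (h • o) = dX o ((g⁻¹ * h) • o) := by
  rw [← dX_smul_smul g o, ← mul_smul, mul_inv_cancel_left]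

theorem dX_comm_le (x y : X) : dX x y ≤ dX y x := by
  obtain ⟨a, rfl⟩ := exists_smul_o_eq x
  obtain ⟨b, rfl⟩ := exists_smul_o_eq y
  refine le_dX fun c hc hc₀ hc₁ => ?_
  have h_pPart (τ : ℝ) : killing (pPart (velocity (fun τ => c (1 - τ)) τ))
      (pPart (velocity (fun τ => c (1 - τ)) τ)) =
        killing (pPart (velocity c (1 - τ))) (pPart (velocity c (1 - τ))) := by
    simp only [hc.velocity_reverse, pPart, killing, transpose_neg, ← neg_add, smul_neg, neg_mul_neg]
  have h_length : curveLength (fun τ => c (1 - τ)) = curveLength c := by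
    simp only [curveLength, h_pPart]
    simpa using intervalIntegral.integral_comp_sub_left (a := 0) (b := 1)
      (fun τ => √(killing (pPart (velocity c τ)) (pPart (velocity c τ)))) 1
  rw [← hc₀, ← hc₁, ← h_length]
  simpa using dX_le_curveLength hc.reverse

theorem dX_comm (x y : X) : dX x y = dX y x := (dX_comm_le x y).antisymm (dX_comm_le y x)

/-! ### Nearest points of `Y` -/

/-- The symmetric matrix of the quadratic form `F`, an involution. -/
def formJ : M₃ := !![0, 0, 1; 0, -1, 0; 1, 0, 0]

theorem formJ_mul_self : formJ * formJ = 1 := by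
  ext i j
  fin_cases i <;> fin_cases j <;> simp [formJ, mul_apply, Fin.sum_univ_three]

theorem formJ_mul_formJ_mul (A : M₃) : formJ * (formJ * A) = A := by
  rw [← mul_assoc, formJ_mul_self, one_mul]

theorem transpose_formJ : formJᵀ = formJ := by
  ext i j
  fin_cases i <;> fin_cases j <;> rfl

theorem isHermitian_formJ : formJ.IsHermitian := transpose_formJ

theorem F_eq_dotProduct_formJ (v : Fin 3 → ℝ) : F v = v ⬝ᵥ formJ *ᵥ v := by
  simp only [F, dotProduct, mulVec, formJ, of_apply, cons_val', cons_val_fin_one,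
    Fin.sum_univ_three, cons_val_zero, cons_val_one, cons_val, zero_mul, add_zero, one_mul,
    zero_add, neg_mul, mul_neg]
  ring

theorem mem_SOF_iff {g : G} : g ∈ SOF ↔ (g : M₃)ᵀ * formJ * (g : M₃) = formJ := by
  have h_mulVec (v : Fin 3 → ℝ) :
      F ((g : M₃) *ᵥ v) = v ⬝ᵥ ((g : M₃)ᵀ * formJ * (g : M₃)) *ᵥ v := by
    rw [F_eq_dotProduct_formJ, ← mulVec_mulVec, ← mulVec_mulVec, dotProduct_mulVec v,
      vecMul_transpose]
  constructor
  · intro hg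
    refine eq_of_forall_dotProduct_mulVec_self_eq ?_ transpose_formJ fun v => ?_
    · rw [IsSymm, transpose_mul, transpose_mul, transpose_transpose, transpose_formJ, mul_assoc]
    · rw [← h_mulVec, ← F_eq_dotProduct_formJ]
      exact hg v
  · intro hg v
    rw [h_mulVec, hg, F_eq_dotProduct_formJ]

section SOF

variable {g h k : G}

theorem formJ_mul_coe_inv (hh : h ∈ SOF) : formJ * ((h⁻¹ : G) : M₃) = (h : M₃)ᵀ * formJ := by
  rw [← mem_SOF_iff.1 hh, mul_assoc, coe_mul_coe_inv, mul_one, mem_SOF_iff.1 hh]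

theorem transpose_coe_inv_mul_formJ (hh : h ∈ SOF) :
    ((h⁻¹ : G) : M₃)ᵀ * formJ = formJ * (h : M₃) := by
  simpa only [transpose_mul, transpose_transpose, transpose_formJ] using
    congrArg transpose (formJ_mul_coe_inv hh)

theorem mul_formJ_mul_transpose (hh : h ∈ SOF) : (h : M₃) * formJ * (h : M₃)ᵀ = formJ := by
  calc (h : M₃) * formJ * (h : M₃)ᵀ = (h : M₃) * formJ * ((h : M₃)ᵀ * formJ) * formJ := by
        simp only [mul_assoc, formJ_mul_self, mul_one]
    _ = formJ := by
        rw [← formJ_mul_coe_inv hh, mul_assoc (h : M₃), formJ_mul_formJ_mul, coe_mul_coe_inv,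
          one_mul]

theorem gram_mul_formJ_mul_gram (hh : h ∈ SOF) : gram h * formJ * gram h = formJ := by
  calc gram h * formJ * gram h
      = (h : M₃) * ((h : M₃)ᵀ * formJ * (h : M₃)) * (h : M₃)ᵀ := by simp only [gram, mul_assoc]
    _ = formJ := by rw [mem_SOF_iff.1 hh, mul_formJ_mul_transpose hh]

theorem formJ_mul_polarLog_mul_formJ (hh : h ∈ SOF) :
    formJ * polarLog h * formJ = -polarLog h := by
  rw [polarLog, mul_smul_comm, smul_mul_assoc, conj_log_eq_neg isHermitian_formJ formJ_mul_self
    (posDef_gram h) (gram_mul_formJ_mul_gram hh), smul_neg]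

theorem expG_mem_SOF {A : M₃} (hA : A.IsHermitian) (hA_trace : A.trace = 0)
    (hJ : formJ * A * formJ = -A) (τ : ℝ) : expG A hA hA_trace τ ∈ SOF := by
  have h_conj : formJ * exp (τ • A) * formJ = (exp (τ • A))⁻¹ := by
    have h := Matrix.exp_units_conj ⟨formJ, formJ, formJ_mul_self, formJ_mul_self⟩ (τ • A)
    simp only [Units.inv_mk, mul_smul_comm, smul_mul_assoc, hJ, smul_neg, Matrix.exp_neg] at h
    exact h.symm
  have h_unit : IsUnit (exp (τ • A)).det := (isUnit_iff_isUnit_det _).1 (Matrix.isUnit_exp _)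
  rw [mem_SOF_iff, coe_expG, ← Matrix.exp_transpose, transpose_smul,
    ← conjTranspose_eq_transpose_of_trivial A, hA.eq]
  calc exp (τ • A) * formJ * exp (τ • A)
      = exp (τ • A) * (formJ * exp (τ • A) * formJ) * formJ := by
        simp only [mul_assoc, formJ_mul_self, mul_one]
    _ = formJ := by rw [h_conj, mul_nonsing_inv _ h_unit, one_mul]

theorem expG_mem_H {A : M₃} (hA : A.IsHermitian) (hA_trace : A.trace = 0)
    (hJ : formJ * A * formJ = -A) : expG A hA hA_trace 1 ∈ H := by
  set c : ℝ → SOF := fun τ => ⟨expG A hA hA_trace τ, expG_mem_SOF hA hA_trace hJ τ⟩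
  have hc : Continuous c :=
    ((isC1Curve_expG hA hA_trace).continuous_coe.subtype_mk _).subtype_mk _
  exact ⟨c 1, (isConnected_range hc).subset_connectedComponent
    ⟨0, Subtype.ext (expG_zero hA hA_trace)⟩ ⟨1, rfl⟩, rfl⟩

theorem exists_mem_H_gram_eq {S : M₃} (hS : S.PosDef) (hSJS : S * formJ * S = formJ) :
    ∃ h ∈ H, gram h = S := by
  have h_log := conj_log_eq_neg isHermitian_formJ formJ_mul_self hS hSJS
  set A : M₃ := (1 / 2 : ℝ) • CFC.log S
  have hA : A.IsHermitian := (IsSelfAdjoint.all (1 / 2 : ℝ)).smul (IsSelfAdjoint.log (a := S))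
  have hJ : formJ * A * formJ = -A := by
    rw [mul_smul_comm, smul_mul_assoc, h_log, smul_neg]
  have hA_trace : A.trace = 0 := by
    have h := congrArg trace hJ
    rw [trace_mul_comm, formJ_mul_formJ_mul, trace_neg] at h
    linarith
  refine ⟨_, expG_mem_H hA hA_trace hJ, ?_⟩
  rw [gram_expG, mul_one, smul_smul, mul_one_div_cancel two_ne_zero, one_smul,
    CFC.exp_log S hS.isStrictlyPositive]

theorem mem_SOF_of_mem_H (hh : h ∈ H) : h ∈ SOF := by
  obtain ⟨x, -, rfl⟩ := hh
  exact x.2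

theorem mem_Y_iff {x : X} : x ∈ Y ↔ ∃ h ∈ SOF, x = h • o := by
  constructor
  · rintro ⟨h, hh, rfl⟩
    exact ⟨h, mem_SOF_of_mem_H hh, rfl⟩
  · rintro ⟨h, hh, rfl⟩
    obtain ⟨k, hk, hkh⟩ := exists_mem_H_gram_eq (posDef_gram h) (gram_mul_formJ_mul_gram hh)
    exact ⟨k, hk, smul_o_eq_smul_o_iff.2 hkh.symm⟩

theorem smul_o_mem_Y (hh : h ∈ SOF) : h • o ∈ Y := mem_Y_iff.2 ⟨h, hh, rfl⟩

/-- For `h ∈ SO(F)`: the point `h o` of `Y` is the foot of the perpendicular from `g o`, that is,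
the geodesic from `o` to `h⁻¹ g o` is orthogonal to `Y`. The tangent space of `Y` at `o` is the
`-1`-eigenspace in `𝔭` of conjugation by `formJ`, its normal space the `1`-eigenspace. -/
def IsFoot (g h : G) : Prop := Commute formJ (gram (h⁻¹ * g))

theorem IsFoot.mul_left (hf : IsFoot g h) (k : G) : IsFoot (k * g) (k * h) := by
  rwa [IsFoot, _root_.mul_inv_rev, mul_assoc, inv_mul_cancel_left]

theorem IsFoot.formJ_mul_polarLog_mul_formJ (hf : IsFoot g h) :
    formJ * polarLog (h⁻¹ * g) * formJ = polarLog (h⁻¹ * g) := by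
  rw [polarLog, mul_smul_comm, smul_mul_assoc, ← log_conj isHermitian_formJ formJ_mul_self
    (posDef_gram _), hf.eq, mul_assoc, formJ_mul_self, mul_one]

theorem killing_polarLog_eq_zero_of_isFoot (hh : h ∈ SOF) (hk : k ∈ SOF) (hf : IsFoot g h) :
    killing (polarLog (h⁻¹ * g)) (polarLog (h⁻¹ * k)) = 0 := by
  rw [killing, trace_mul_eq_zero_of_conj hf.formJ_mul_polarLog_mul_formJ
    (formJ_mul_polarLog_mul_formJ (SOF.mul_mem (SOF.inv_mem hh) hk)), mul_zero]

theorem IsFoot.dX_lt (hf : IsFoot g h) (hh : h ∈ SOF) (hk : k ∈ SOF) (hne : k • o ≠ h • o) :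
    dX (g • o) (h • o) < dX (g • o) (k • o) := by
  set A := polarLog (h⁻¹ * g)
  set B := polarLog (h⁻¹ * k)
  have hB : B ≠ 0 := fun hB => hne <| by
    have h_gram : gram (h⁻¹ * k) = gram 1 := by
      rw [← exp_two_smul_polarLog, show polarLog _ = 0 from hB, smul_zero, exp_zero, gram_one]
    rw [← mul_inv_cancel_left h k, mul_smul, smul_o_eq_smul_o_iff.2 h_gram, one_smul]
  have h_pythagoras : killing (A - B) (A - B) = killing A A + killing B B := by
    have h_orth : killing A B = 0 := killing_polarLog_eq_zero_of_isFoot hh hk hf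
    simp only [killing, sub_mul, mul_sub, trace_sub, trace_mul_comm B A] at h_orth ⊢
    linarith
  calc dX (g • o) (h • o) = dX o ((h⁻¹ * g) • o) := by rw [dX_comm, dX_smul_o_smul_o]
    _ ≤ √(killing A A) := dX_o_smul_o_le _
    _ < √(killing (A - B) (A - B)) := by
      refine Real.sqrt_lt_sqrt (killing_self_nonneg (isHermitian_polarLog _)) ?_
      rw [h_pythagoras]
      exact lt_add_of_pos_right _ (killing_self_pos (isHermitian_polarLog _) hB)
    _ ≤ dX ((h⁻¹ * k) • o) ((h⁻¹ * g) • o) := sqrt_killing_polarLog_sub_le_dX _ _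
    _ = dX (g • o) (k • o) := by rw [mul_smul, mul_smul, dX_smul_smul, dX_comm]

theorem isFoot_of_gram_mul_mul_gram_eq (hh : h ∈ SOF)
    (h_eq : gram h * (formJ * gram g * formJ) * gram h = gram g) : IsFoot g h := by
  have h_gram : gram (h⁻¹ * g) = formJ * gram (h⁻¹ * g) * formJ := by
    calc gram (h⁻¹ * g)
        = ((h⁻¹ : G) : M₃) * (gram h * (formJ * gram g * formJ) * gram h) *
            ((h⁻¹ : G) : M₃)ᵀ := by rw [gram_mul, h_eq]
      _ = ((h⁻¹ : G) : M₃) * (h : M₃) * ((h : M₃)ᵀ * formJ) * gram g * (formJ * (h : M₃)) *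
            (((h⁻¹ : G) : M₃) * (h : M₃))ᵀ := by
          simp only [gram, transpose_mul, mul_assoc]
      _ = formJ * ((h⁻¹ : G) : M₃) * gram g * (((h⁻¹ : G) : M₃)ᵀ * formJ) := by
          rw [coe_inv_mul_coe, transpose_one, one_mul, mul_one, formJ_mul_coe_inv hh,
            transpose_coe_inv_mul_formJ hh]
      _ = formJ * gram (h⁻¹ * g) * formJ := by rw [gram_mul]; simp only [mul_assoc]
  rw [IsFoot, Commute, SemiconjBy]
  nth_rw 2 [h_gram]
  rw [mul_assoc _ formJ formJ, formJ_mul_self, mul_one]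

/-- `gram h` is the midpoint of `gram g` and its mirror image `formJ * (gram g)⁻¹ * formJ`. -/
theorem exists_isFoot (g : G) : ∃ h ∈ SOF, IsFoot g h := by
  obtain ⟨S, hS, hS_eq⟩ := exists_posDef_mul_mul_eq
    (posDef_conj isHermitian_formJ (IsUnit.of_mul_eq_one _ formJ_mul_self) (posDef_gram g))
    (posDef_gram g)
  obtain ⟨h, hh, rfl⟩ := exists_mem_H_gram_eq hS
    (mul_mul_eq_of_mul_conj_mul_eq isHermitian_formJ formJ_mul_self (posDef_gram g) hS hS_eq)
  exact ⟨h, mem_SOF_of_mem_H hh, isFoot_of_gram_mul_mul_gram_eq (mem_SOF_of_mem_H hh) hS_eq⟩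

theorem exists_isNearestPointProjection : ∃ π, IsNearestPointProjection π := by
  have h_foot (x : X) : ∃ h ∈ SOF, ∃ g : G, g • o = x ∧ IsFoot g h := by
    obtain ⟨g, rfl⟩ := exists_smul_o_eq x
    obtain ⟨h, hh, hf⟩ := exists_isFoot g
    exact ⟨h, hh, g, rfl, hf⟩
  choose φ hφ g hg hf using h_foot
  refine ⟨fun x => φ x • o, fun x => ⟨smul_o_mem_Y (hφ x), fun y hy hne => ?_⟩⟩
  obtain ⟨k, hk, rfl⟩ := mem_Y_iff.1 hy
  simpa only [hg] using (hf x).dX_lt (hφ x) hk hne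

theorem IsNearestPointProjection.eq_of_isFoot {π : X → X} (hπ : IsNearestPointProjection π)
    (hh : h ∈ SOF) (hf : IsFoot g h) : π (g • o) = h • o := by
  by_contra hne
  obtain ⟨k, hk, hk_eq⟩ := mem_Y_iff.1 (hπ (g • o)).1
  have h_lt := (hπ (g • o)).2 (h • o) (smul_o_mem_Y hh) (Ne.symm hne)
  rw [hk_eq] at h_lt hne
  exact lt_asymm h_lt (hf.dX_lt hh hk hne)

end SOF

/-! ### Projections of floating planes -/

theorem coe_aDiag (t : ℝ) :
    (aDiag t : M₃) = diagonal ![Real.exp t, Real.exp (-2 * t), Real.exp t] := rfl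

theorem coe_hDiag (s : ℝ) :
    (hDiag s : M₃) = diagonal ![Real.exp s, 1, Real.exp (-s)] := rfl

theorem hDiag_inv (s : ℝ) : (hDiag s)⁻¹ = hDiag (-s) := by
  rw [inv_eq_iff_mul_eq_one]
  refine Subtype.ext ?_
  rw [Matrix.SpecialLinearGroup.coe_mul, coe_hDiag, coe_hDiag, diagonal_mul_diagonal,
    Matrix.SpecialLinearGroup.coe_one, ← diagonal_one]
  congr 1
  funext i
  fin_cases i <;> simp [← Real.exp_add]

theorem hDiag_mem_SOF (s : ℝ) : hDiag s ∈ SOF := by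
  rw [mem_SOF_iff, coe_hDiag, diagonal_transpose]
  ext i j
  rw [mul_diagonal, diagonal_mul]
  fin_cases i <;> fin_cases j <;> simp [formJ, ← Real.exp_add]

section FloatingPlane

variable {h k : G} {t : ℝ}

theorem mul_formJ_mul_transpose_mul_inv_gram_mul (g : G) :
    (g : M₃) * formJ * (g : M₃)ᵀ * (gram g)⁻¹ * ((g : M₃) * formJ * (g : M₃)ᵀ) = gram g := by
  have h_det : IsUnit (g : M₃).det := (isUnit_iff_isUnit_det _).1 (isUnit_coe g)
  have h_det_transpose : IsUnit (g : M₃)ᵀ.det := by rwa [det_transpose]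
  calc (g : M₃) * formJ * (g : M₃)ᵀ * (gram g)⁻¹ * ((g : M₃) * formJ * (g : M₃)ᵀ)
      = (g : M₃) * formJ * ((g : M₃)ᵀ * ((g : M₃)ᵀ)⁻¹) * ((g : M₃)⁻¹ * (g : M₃)) *
          (formJ * (g : M₃)ᵀ) := by simp only [gram, Matrix.mul_inv_rev, mul_assoc]
    _ = gram g := by
      rw [mul_nonsing_inv _ h_det_transpose, nonsing_inv_mul _ h_det, mul_one, mul_one,
        mul_assoc, formJ_mul_formJ_mul, gram]

theorem aDiag_mul_formJ_mul_transpose (t : ℝ) :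
    (aDiag t : M₃) * formJ * (aDiag t : M₃)ᵀ = Real.exp (2 * t) • formJ +
      (Real.exp (2 * t) - Real.exp (-4 * t)) • vecMulVec (Pi.single 1 1) (Pi.single 1 1) := by
  have h₂ : Real.exp t * Real.exp t = Real.exp (2 * t) := by rw [← Real.exp_add]; ring_nf
  have h₄ : Real.exp (-(2 * t)) * Real.exp (-(2 * t)) = Real.exp (-(4 * t)) := by
    rw [← Real.exp_add]; ring_nf
  rw [coe_aDiag, diagonal_transpose]
  ext i j
  rw [mul_diagonal, diagonal_mul]
  fin_cases i <;> fin_cases j <;> simp [formJ, vecMulVec, ← h₂, ← h₄]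
  ring

theorem inv_mul_aDiag_mul_formJ_mul_transpose (hh : h ∈ SOF) (hk : k ∈ SOF) :
    ((h⁻¹ * (aDiag t * k) : G) : M₃) * formJ * ((h⁻¹ * (aDiag t * k) : G) : M₃)ᵀ =
      Real.exp (2 * t) • formJ + (Real.exp (2 * t) - Real.exp (-4 * t)) •
        vecMulVec (((h⁻¹ : G) : M₃).col 1) (((h⁻¹ : G) : M₃).col 1) := by
  set b := ((h⁻¹ : G) : M₃)
  calc ((h⁻¹ * (aDiag t * k) : G) : M₃) * formJ * ((h⁻¹ * (aDiag t * k) : G) : M₃)ᵀ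
      = b * ((aDiag t : M₃) * ((k : M₃) * formJ * (k : M₃)ᵀ) * (aDiag t : M₃)ᵀ) * bᵀ := by
        simp only [Matrix.SpecialLinearGroup.coe_mul, transpose_mul, mul_assoc, b]
    _ = Real.exp (2 * t) • (b * formJ * bᵀ) + (Real.exp (2 * t) - Real.exp (-4 * t)) •
          (b * vecMulVec (Pi.single 1 1) (Pi.single 1 1) * bᵀ) := by
        rw [mul_formJ_mul_transpose hk, aDiag_mul_formJ_mul_transpose, mul_add, add_mul,
          mul_smul_comm, smul_mul_assoc, mul_smul_comm, smul_mul_assoc]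
    _ = _ := by
        rw [mul_formJ_mul_transpose (SOF.inv_mem hh), mul_vecMulVec, vecMulVec_mul,
          vecMul_transpose, mulVec_single_one]

theorem formJ_mul_mul_formJ_apply_one_one (A : M₃) : (formJ * A * formJ) 1 1 = A 1 1 := by
  simp [formJ, mul_apply, vecMul, dotProduct, Fin.sum_univ_three]

theorem gram_apply_one_one (hh : h ∈ SOF) :
    gram h 1 1 = ((h⁻¹ : G) : M₃).col 1 ⬝ᵥ ((h⁻¹ : G) : M₃).col 1 := by
  have h_gram : gram h = formJ * (((h⁻¹ : G) : M₃)ᵀ * ((h⁻¹ : G) : M₃)) * formJ := by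
    calc gram h = formJ * (formJ * (h : M₃)) * ((h : M₃)ᵀ * formJ * formJ) := by
          rw [formJ_mul_formJ_mul, mul_assoc _ formJ formJ, formJ_mul_self, mul_one, gram]
      _ = formJ * (((h⁻¹ : G) : M₃)ᵀ * (formJ * formJ) * ((h⁻¹ : G) : M₃)) * formJ := by
          rw [← formJ_mul_coe_inv hh, ← transpose_coe_inv_mul_formJ hh]
          simp only [mul_assoc]
      _ = formJ * (((h⁻¹ : G) : M₃)ᵀ * ((h⁻¹ : G) : M₃)) * formJ := by
          rw [formJ_mul_self, mul_one]
  rw [h_gram, formJ_mul_mul_formJ_apply_one_one]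
  rfl

theorem col_dotProduct_formJ_mulVec_col (hh : h ∈ SOF) :
    (h : M₃).col 1 ⬝ᵥ formJ *ᵥ (h : M₃).col 1 = -1 := by
  calc (h : M₃).col 1 ⬝ᵥ formJ *ᵥ (h : M₃).col 1 = ((h : M₃)ᵀ * formJ * (h : M₃)) 1 1 := by
        rw [dotProduct_mulVec, mul_apply_eq_vecMul, mul_apply_eq_vecMul]
        rfl
    _ = -1 := by
        rw [mem_SOF_iff.1 hh]
        rfl

theorem le_inv_exp_sub_one_of_mem_Icc {a ε : ℝ} (hε : 0 < ε) (ht : ε < |t|)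
    (h_mem : (Real.exp (2 * t) - Real.exp (-4 * t)) * a ∈
      Set.Icc (-Real.exp (2 * t)) (Real.exp (-4 * t))) : a ≤ (Real.exp (6 * ε) - 1)⁻¹ := by
  have h_pos : 0 < Real.exp (6 * ε) - 1 := sub_pos.2 (Real.one_lt_exp_iff.2 (by positivity))
  rcases le_total a 0 with ha | ha
  · exact ha.trans (inv_pos.2 h_pos).le
  suffices h : (Real.exp (6 * |t|) - 1) * a ≤ 1 by
    rw [← one_div, le_div_iff₀' h_pos]
    refine le_trans ?_ h
    gcongr
  rcases abs_cases t with ⟨h_abs, -⟩ | ⟨h_abs, -⟩ <;> rw [h_abs]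
  · have h_exp : Real.exp (2 * t) = Real.exp (-4 * t) * Real.exp (6 * t) := by
      rw [← Real.exp_add]; ring_nf
    refine le_of_mul_le_mul_left ?_ (Real.exp_pos (-4 * t))
    linear_combination h_mem.2 - a * h_exp
  · have h_exp : Real.exp (-4 * t) = Real.exp (2 * t) * Real.exp (6 * -t) := by
      rw [← Real.exp_add]; ring_nf
    refine le_of_mul_le_mul_left ?_ (Real.exp_pos (2 * t))
    linear_combination h_mem.1 - a * h_exp

theorem IsFoot.gram_apply_one_one_le {ε : ℝ} (hε : 0 < ε) (ht : ε < |t|) (hh : h ∈ SOF)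
    (hk : k ∈ SOF) (hf : IsFoot (aDiag t * k) h) :
    gram h 1 1 ≤ 1 + 2 * (Real.exp (6 * ε) - 1)⁻¹ := by
  set w := ((h⁻¹ : G) : M₃).col 1
  have hw : w ⬝ᵥ formJ *ᵥ w = -1 := col_dotProduct_formJ_mulVec_col (SOF.inv_mem hh)
  have h_gram : gram h 1 1 = w ⬝ᵥ w := gram_apply_one_one hh
  have h_le := le_inv_exp_sub_one_of_mem_Icc hε ht
    (sub_mul_half_dotProduct_sub_one_mem_Icc isHermitian_formJ formJ_mul_self (posDef_gram _) hf hw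
      (Real.exp_pos (2 * t)) (Real.exp_pos (-4 * t))
      (inv_mul_aDiag_mul_formJ_mul_transpose hh hk)
      (mul_formJ_mul_transpose_mul_inv_gram_mul _))
  linarith

theorem trace_gram_inv_eq_of_mem_SOF (hh : h ∈ SOF) : (gram h)⁻¹.trace = (gram h).trace := by
  have h_inv : (gram h)⁻¹ = formJ * gram h * formJ := by
    refine inv_eq_left_inv ?_
    rw [mul_assoc, mul_assoc, ← mul_assoc (gram h), gram_mul_formJ_mul_gram hh, formJ_mul_self]
  rw [h_inv, mul_assoc, trace_mul_comm, mul_assoc, formJ_mul_self, mul_one]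

theorem dX_o_smul_o_le_sqrt_trace_of_mem_SOF (hh : h ∈ SOF) :
    dX o (h • o) ≤ √(3 * ((gram h).trace - 3)) := by
  refine (dX_o_smul_o_le_sqrt_trace h).trans_eq ?_
  rw [trace_gram_inv_eq_of_mem_SOF hh]
  ring_nf

theorem trace_gram_hDiag_mul (s : ℝ) (h : G) : (gram (hDiag s * h)).trace =
    Real.exp (2 * s) * gram h 0 0 + gram h 1 1 + Real.exp (-(2 * s)) * gram h 2 2 := by
  rw [gram_mul, coe_hDiag, diagonal_transpose, trace_fin_three]
  simp only [mul_diagonal, diagonal_mul, cons_val]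
  rw [mul_right_comm, ← Real.exp_add, mul_right_comm (Real.exp (-s)), ← Real.exp_add]
  ring_nf

theorem sqrt_gram_apply_mul_gram_apply_le (hh : h ∈ SOF) :
    √(gram h 0 0 * gram h 2 2) ≤ 1 + gram h 1 1 := by
  have h_symm (i j : Fin 3) : gram h i j = gram h j i := (posDef_gram h).isHermitian.apply j i
  have h_pos : 0 < gram h 1 1 := (posDef_gram h).diag_pos
  have h_entry (i j : Fin 3) : gram h i 0 * gram h 2 j - gram h i 1 * gram h 1 j +
      gram h i 2 * gram h 0 j = formJ i j := by
    rw [← gram_mul_formJ_mul_gram hh]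
    simp only [formJ, mul_apply, of_apply, cons_val', cons_val_fin_one, Fin.sum_univ_three,
      cons_val_zero, cons_val_one, cons_val, mul_zero, add_zero, mul_one, zero_add, mul_neg,
      neg_mul]
    ring
  have h₀₂ : gram h 0 0 * gram h 2 2 - gram h 0 1 * gram h 1 2 + gram h 0 2 ^ 2 = 1 := by
    rw [sq]; exact h_entry 0 2
  have h₁₁ : 2 * (gram h 0 1 * gram h 1 2) - gram h 1 1 ^ 2 = -1 := by
    refine Eq.trans ?_ (h_entry 1 1)
    rw [h_symm 1 0, h_symm 2 1]
    ring
  refine Real.sqrt_le_iff.2 ⟨by positivity, ?_⟩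
  linarith [sq_nonneg (gram h 0 2), sq_nonneg (gram h 1 1), add_sq 1 (gram h 1 1)]

theorem exists_trace_gram_hDiag_mul_le (hh : h ∈ SOF) :
    ∃ s, (gram (hDiag s * h)).trace ≤ 2 + 3 * gram h 1 1 := by
  have hx : 0 < gram h 0 0 := (posDef_gram h).diag_pos
  have hy : 0 < gram h 2 2 := (posDef_gram h).diag_pos
  refine ⟨Real.log (√(gram h 2 2) / √(gram h 0 0)) / 2, ?_⟩
  rw [trace_gram_hDiag_mul, mul_div_cancel₀ _ two_ne_zero, Real.exp_neg,
    Real.exp_log (by positivity), inv_div]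
  calc √(gram h 2 2) / √(gram h 0 0) * gram h 0 0 + gram h 1 1 +
        √(gram h 0 0) / √(gram h 2 2) * gram h 2 2
      = 2 * √(gram h 0 0 * gram h 2 2) + gram h 1 1 := by
        rw [Real.sqrt_mul hx.le, div_mul_eq_mul_div, div_mul_eq_mul_div, mul_div_assoc,
          mul_div_assoc, Real.div_sqrt, Real.div_sqrt]
        ring
    _ ≤ 2 + 3 * gram h 1 1 := by linarith [sqrt_gram_apply_mul_gram_apply_le hh]

theorem IsFoot.exists_dX_hDiag_smul_o_le {ε : ℝ} (hε : 0 < ε) (ht : ε < |t|) (hh : h ∈ SOF)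
    (hk : k ∈ SOF) (hf : IsFoot (aDiag t * k) h) :
    ∃ s, dX (h • o) (hDiag s • o) ≤ √(6 + 18 * (Real.exp (6 * ε) - 1)⁻¹) := by
  obtain ⟨s, hs⟩ := exists_trace_gram_hDiag_mul_le hh
  refine ⟨-s, ?_⟩
  rw [dX_comm, dX_smul_o_smul_o, hDiag_inv, neg_neg]
  refine (dX_o_smul_o_le_sqrt_trace_of_mem_SOF (SOF.mul_mem (hDiag_mem_SOF s) hh)).trans ?_
  exact Real.sqrt_le_sqrt (by linarith [hf.gram_apply_one_one_le hε ht hh hk])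

theorem IsNearestPointProjection.exists_mem_geodesic_dX_le {π : X → X}
    (hπ : IsNearestPointProjection π) {ε : ℝ} (hε : 0 < ε) (ht : ε < |t|) (hh : h ∈ SOF) {p : X}
    (hp : p ∈ π '' floatingPlane h t) :
    ∃ q ∈ geodesic h, dX p q ≤ √(6 + 18 * (Real.exp (6 * ε) - 1)⁻¹) := by
  obtain ⟨_, ⟨y, hy, rfl⟩, rfl⟩ := hp
  obtain ⟨k, hk, rfl⟩ := mem_Y_iff.1 hy
  obtain ⟨h', hh', hf⟩ := exists_isFoot (aDiag t * k)
  obtain ⟨s, hs⟩ := hf.exists_dX_hDiag_smul_o_le hε ht hh' hk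
  refine ⟨h • hDiag s • o, ⟨s, rfl⟩, ?_⟩
  have h_proj : π (h • aDiag t • k • o) = h • h' • o := by
    simpa only [mul_smul] using hπ.eq_of_isFoot (SOF.mul_mem hh hh') (hf.mul_left h)
  rwa [h_proj, dX_smul_smul]

end FloatingPlane

/-! ### Projections of the geodesics `γ t` -/

section Gamma

variable {t s r : ℝ}

theorem inv_sqrt_two_mul_self : (√2)⁻¹ * (√2)⁻¹ = (1 / 2 : ℝ) := by
  rw [← mul_inv, Real.mul_self_sqrt zero_le_two, one_div]

theorem transpose_k₀_mul_k₀ : (k₀ : M₃)ᵀ * (k₀ : M₃) = 1 := by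
  ext i j
  fin_cases i <;> fin_cases j <;>
    simp [k₀, mul_apply, Fin.sum_univ_three, inv_sqrt_two_mul_self] <;> norm_num

theorem coe_k₀_inv : ((k₀⁻¹ : G) : M₃) = (k₀ : M₃)ᵀ :=
  (left_inv_eq_right_inv transpose_k₀_mul_k₀ (coe_mul_coe_inv k₀)).symm

theorem k₀_smul_o : k₀ • o = o := by
  have h_gram : gram k₀ = gram 1 := by rw [gram_one, gram, ← coe_k₀_inv, coe_mul_coe_inv]
  rw [smul_o_eq_smul_o_iff.2 h_gram, one_smul]

theorem k₀_mem_SOF : k₀ ∈ SOF := by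
  rw [mem_SOF_iff]
  ext i j
  fin_cases i <;> fin_cases j <;>
    simp [k₀, formJ, mul_apply, Fin.sum_univ_three, inv_sqrt_two_mul_self] <;> norm_num

theorem coe_k₀_inv_mul_aDiag_mul_k₀ (t : ℝ) : ((k₀⁻¹ * aDiag t * k₀ : G) : M₃) =
    !![(Real.exp t + Real.exp (-2 * t)) / 2, 0, (Real.exp t - Real.exp (-2 * t)) / 2;
      0, Real.exp t, 0;
      (Real.exp t - Real.exp (-2 * t)) / 2, 0, (Real.exp t + Real.exp (-2 * t)) / 2] := by
  rw [Matrix.SpecialLinearGroup.coe_mul, Matrix.SpecialLinearGroup.coe_mul, coe_k₀_inv,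
    coe_aDiag]
  ext i j
  rw [mul_apply, Fin.sum_univ_three]
  simp only [mul_diagonal]
  fin_cases i <;> fin_cases j <;> simp [k₀]
  · linear_combination Real.exp (-(2 * t)) * inv_sqrt_two_mul_self
  · linear_combination -Real.exp (-(2 * t)) * inv_sqrt_two_mul_self
  · linear_combination 2 * Real.exp t * inv_sqrt_two_mul_self
  · linear_combination -Real.exp (-(2 * t)) * inv_sqrt_two_mul_self
  · linear_combination Real.exp (-(2 * t)) * inv_sqrt_two_mul_self

theorem commute_formJ_mul_transpose {a b c d m : ℝ} (h : a ^ 2 + b ^ 2 = c ^ 2 + d ^ 2) :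
    Commute formJ (!![a, 0, b; 0, m, 0; c, 0, d] * !![a, 0, b; 0, m, 0; c, 0, d]ᵀ) := by
  have h_mul : !![a, 0, b; 0, m, 0; c, 0, d] * !![a, 0, b; 0, m, 0; c, 0, d]ᵀ =
      !![a ^ 2 + b ^ 2, 0, a * c + b * d; 0, m ^ 2, 0; a * c + b * d, 0, a ^ 2 + b ^ 2] := by
    nth_rw 2 [h]
    ext i j
    fin_cases i <;> fin_cases j <;>
      simp [mul_apply, Fin.sum_univ_three] <;> ring
  rw [h_mul, Commute, SemiconjBy]
  ext i j
  fin_cases i <;> fin_cases j <;> simp [formJ, mul_apply, Fin.sum_univ_three]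

theorem exp_sq_add_exp_sq (t : ℝ) : Real.exp t ^ 2 + Real.exp (-2 * t) ^ 2 =
    2 * (Real.exp t * Real.exp (-2 * t)) * Real.cosh (3 * t) := by
  have h₁ : Real.exp t ^ 2 = Real.exp t * Real.exp (-2 * t) * Real.exp (3 * t) := by
    rw [sq, ← Real.exp_add, ← Real.exp_add, ← Real.exp_add]
    ring_nf
  have h₂ : Real.exp (-2 * t) ^ 2 = Real.exp t * Real.exp (-2 * t) * Real.exp (-(3 * t)) := by
    rw [sq, ← Real.exp_add, ← Real.exp_add, ← Real.exp_add]
    ring_nf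
  rw [h₁, h₂, Real.cosh_eq]
  ring

theorem sq_add_sq_eq_of_tanh_eq
    (hr : Real.tanh (2 * r) = Real.tanh (2 * s) / Real.cosh (3 * t)) :
    (Real.exp (-r) * ((Real.exp t + Real.exp (-2 * t)) / 2) * Real.exp s) ^ 2 +
        (Real.exp (-r) * ((Real.exp t - Real.exp (-2 * t)) / 2) * Real.exp (-s)) ^ 2 =
      (Real.exp r * ((Real.exp t - Real.exp (-2 * t)) / 2) * Real.exp s) ^ 2 +
        (Real.exp r * ((Real.exp t + Real.exp (-2 * t)) / 2) * Real.exp (-s)) ^ 2 := by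
  have h_tanh : Real.sinh (2 * r) * (Real.cosh (2 * s) * Real.cosh (3 * t)) =
      Real.cosh (2 * r) * Real.sinh (2 * s) := by
    rw [Real.tanh_eq_sinh_div_cosh, Real.tanh_eq_sinh_div_cosh, div_div,
      div_eq_div_iff (Real.cosh_pos _).ne' (by positivity)] at hr
    rw [hr, mul_comm]
  have h_cosh (x : ℝ) : Real.cosh (2 * x) = (Real.exp x ^ 2 + Real.exp (-x) ^ 2) / 2 := by
    rw [Real.cosh_two_mul, Real.cosh_eq, Real.sinh_eq]
    ring
  have h_sinh (x : ℝ) : Real.sinh (2 * x) = (Real.exp x ^ 2 - Real.exp (-x) ^ 2) / 2 := by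
    rw [Real.sinh_two_mul, Real.cosh_eq, Real.sinh_eq]
    ring
  rw [h_sinh, h_cosh, h_cosh, h_sinh] at h_tanh
  linear_combination -2 * (Real.exp t * Real.exp (-2 * t)) * h_tanh -
    (Real.exp s ^ 2 + Real.exp (-s) ^ 2) / 2 * ((Real.exp r ^ 2 - Real.exp (-r) ^ 2) / 2) *
      exp_sq_add_exp_sq t

theorem isFoot_k₀_mul_hDiag (hr : Real.tanh (2 * r) = Real.tanh (2 * s) / Real.cosh (3 * t)) :
    IsFoot (aDiag t * (k₀ * hDiag s)) (k₀ * hDiag r) := by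
  have h_eq : (k₀ * hDiag r)⁻¹ * (aDiag t * (k₀ * hDiag s)) =
      hDiag (-r) * (k₀⁻¹ * aDiag t * k₀) * hDiag s := by
    rw [← hDiag_inv]; group
  set p := (Real.exp t + Real.exp (-2 * t)) / 2
  set q := (Real.exp t - Real.exp (-2 * t)) / 2
  have h_coe : ((hDiag (-r) * (k₀⁻¹ * aDiag t * k₀) * hDiag s : G) : M₃) =
      !![Real.exp (-r) * p * Real.exp s, 0, Real.exp (-r) * q * Real.exp (-s); 0, Real.exp t, 0;
        Real.exp r * q * Real.exp s, 0, Real.exp r * p * Real.exp (-s)] := by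
    rw [Matrix.SpecialLinearGroup.coe_mul, Matrix.SpecialLinearGroup.coe_mul,
      coe_k₀_inv_mul_aDiag_mul_k₀, coe_hDiag, coe_hDiag, neg_neg]
    ext i j
    rw [mul_diagonal, diagonal_mul]
    fin_cases i <;> fin_cases j <;> simp [p, q]
  rw [IsFoot, h_eq, gram, h_coe]
  exact commute_formJ_mul_transpose (sq_add_sq_eq_of_tanh_eq hr)

theorem tanh_le_tanh_iff {x y : ℝ} : Real.tanh x ≤ Real.tanh y ↔ x ≤ y := by
  rw [← Real.artanh_le_artanh_iff ⟨Real.neg_one_lt_tanh x, Real.tanh_lt_one x⟩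
    ⟨Real.neg_one_lt_tanh y, Real.tanh_lt_one y⟩, Real.artanh_tanh, Real.artanh_tanh]

theorem abs_tanh (x : ℝ) : |Real.tanh x| = Real.tanh |x| := by
  rw [Real.tanh_eq_sinh_div_cosh, Real.tanh_eq_sinh_div_cosh, abs_div, Real.abs_sinh,
    abs_of_pos (Real.cosh_pos x), Real.cosh_abs]

theorem dX_o_hDiag_smul_o_le (r : ℝ) :
    dX o (hDiag r • o) ≤ √(6 * (Real.cosh (2 * r) - 1)) := by
  refine (dX_o_smul_o_le_sqrt_trace_of_mem_SOF (hDiag_mem_SOF r)).trans_eq ?_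
  rw [← mul_one (hDiag r), trace_gram_hDiag_mul, gram_one, Real.cosh_eq]
  simp only [one_apply_eq]
  ring_nf

theorem IsNearestPointProjection.dX_o_γ_le {π : X → X} (hπ : IsNearestPointProjection π) {ρ : ℝ}
    (hρ : |Real.tanh (2 * s) / Real.cosh (3 * t)| ≤ Real.tanh ρ) :
    dX o (π (γ t s)) ≤ √(6 * (Real.cosh ρ - 1)) := by
  obtain ⟨r, hr⟩ : ∃ r, Real.tanh (2 * r) = Real.tanh (2 * s) / Real.cosh (3 * t) := by
    refine ⟨Real.artanh (Real.tanh (2 * s) / Real.cosh (3 * t)) / 2, ?_⟩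
    rw [mul_div_cancel₀ _ two_ne_zero, Real.tanh_artanh]
    exact abs_lt.1 (hρ.trans_lt (Real.tanh_lt_one ρ))
  have hr_le : |2 * r| ≤ ρ := by rwa [← tanh_le_tanh_iff, ← abs_tanh, hr]
  have h_proj : π (γ t s) = k₀ • hDiag r • o := by
    simpa only [γ, mul_smul] using hπ.eq_of_isFoot
      (SOF.mul_mem k₀_mem_SOF (hDiag_mem_SOF r)) (isFoot_k₀_mul_hDiag hr)
  calc dX o (π (γ t s)) = dX (k₀ • o) (k₀ • hDiag r • o) := by rw [h_proj, k₀_smul_o]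
    _ = dX o (hDiag r • o) := dX_smul_smul _ _ _
    _ ≤ √(6 * (Real.cosh (2 * r) - 1)) := dX_o_hDiag_smul_o_le r
    _ ≤ √(6 * (Real.cosh ρ - 1)) := by
      gcongr
      exact Real.cosh_le_cosh.2 (hr_le.trans (le_abs_self ρ))

theorem IsNearestPointProjection.dX_o_γ_le_of_lt_abs {π : X → X}
    (hπ : IsNearestPointProjection π) {ε : ℝ} (hε : 0 < ε) (ht : ε < |t|) :
    dX o (π (γ t s)) ≤ √(6 * (Real.cosh (Real.artanh (Real.cosh (3 * ε))⁻¹) - 1)) := by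
  have h_cosh : 1 < Real.cosh (3 * ε) := Real.one_lt_cosh.2 (by positivity)
  refine hπ.dX_o_γ_le ?_
  rw [Real.tanh_artanh ⟨by linarith [inv_pos.2 (Real.cosh_pos (3 * ε))],
    inv_lt_one_of_one_lt₀ h_cosh⟩, abs_div, abs_of_pos (Real.cosh_pos _), ← one_div]
  gcongr
  · rw [abs_tanh]
    exact (Real.tanh_lt_one _).le
  · rw [Real.cosh_le_cosh, abs_mul, abs_mul, abs_of_pos hε]
    gcongr

theorem IsNearestPointProjection.dX_o_γ_le_of_abs_le {π : X → X}
    (hπ : IsNearestPointProjection π) {C : ℝ} (hs : |s| ≤ C) :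
    dX o (π (γ t s)) ≤ √(6 * (Real.cosh (2 * C) - 1)) := by
  refine hπ.dX_o_γ_le ?_
  calc |Real.tanh (2 * s) / Real.cosh (3 * t)| = |Real.tanh (2 * s)| / Real.cosh (3 * t) := by
        rw [abs_div, abs_of_pos (Real.cosh_pos _)]
    _ ≤ |Real.tanh (2 * s)| := div_le_self (abs_nonneg _) (Real.one_le_cosh _)
    _ = Real.tanh (2 * |s|) := by rw [abs_tanh, abs_mul, abs_two]
    _ ≤ Real.tanh (2 * C) := tanh_le_tanh_iff.2 (by linarith)

end Gamma

theorem mainTheorem5_general :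
    ∃ π : X → X, IsNearestPointProjection π ∧
      (∀ ε : ℝ, 0 < ε → ∃ R : ℝ, ∀ h ∈ H, ∀ p ∈ ⋃ t ∈ {t : ℝ | ε < |t|}, π '' floatingPlane h t,
        ∃ q ∈ geodesic h, dX p q ≤ R) ∧
      (∀ ε : ℝ, 0 < ε → ∃ R : ℝ, ∀ t s : ℝ, ε < |t| → dX o (π (γ t s)) ≤ R) ∧
      ∀ C : ℝ, ∃ R : ℝ, ∀ t s : ℝ, |s| ≤ C → dX o (π (γ t s)) ≤ R := by
  obtain ⟨π, hπ⟩ := exists_isNearestPointProjection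
  refine ⟨π, hπ,
    fun ε hε => ⟨√(6 + 18 * (Real.exp (6 * ε) - 1)⁻¹), fun h hh p hp => ?_⟩,
    fun ε hε => ⟨_, fun t s ht => hπ.dX_o_γ_le_of_lt_abs hε ht⟩,
    fun C => ⟨_, fun t s hs => hπ.dX_o_γ_le_of_abs_le hs⟩⟩
  simp only [Set.mem_iUnion] at hp
  obtain ⟨t, ht, hpt⟩ := hp
  exact hπ.exists_mem_geodesic_dX_le hε ht (mem_SOF_of_mem_H hh) hpt

end FloatingPlanes

end

theorem mainTheorem5 :
    ∃ π : FloatingPlanes.X → FloatingPlanes.X,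
      FloatingPlanes.IsNearestPointProjection π ∧
      -- for every geodesic `L = h A₀ o` of `Y`, the union of the `π(Y_{L,t})`, `|t| > ε`,
      -- lies within a bounded distance from `L`
      (∀ h ∈ FloatingPlanes.H, ∀ ε : ℝ, 0 < ε → ∃ R : ℝ,
        ∀ p ∈ ⋃ t ∈ {t : ℝ | ε < |t|}, π '' FloatingPlanes.floatingPlane h t,
          ∃ q ∈ FloatingPlanes.geodesic h, FloatingPlanes.dX p q ≤ R) ∧
      -- if `t_n` is bounded (and `|t_n| > ε`), then `π(γ_{t_n}(s_n))` is bounded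
      (∀ ε : ℝ, 0 < ε → ∀ t s : ℕ → ℝ, (∀ n, ε < |t n|) → (∃ C : ℝ, ∀ n, |t n| ≤ C) →
        ∃ R : ℝ, ∀ n,
          FloatingPlanes.dX FloatingPlanes.o (π (FloatingPlanes.γ (t n) (s n))) ≤ R) ∧
      -- if `|s_n|` is bounded, then `π(γ_{t_n}(s_n))` is bounded
      (∀ t s : ℕ → ℝ, (∃ C : ℝ, ∀ n, |s n| ≤ C) →
        ∃ R : ℝ, ∀ n,
          FloatingPlanes.dX FloatingPlanes.o (π (FloatingPlanes.γ (t n) (s n))) ≤ R) := by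
  obtain ⟨π, hπ, h_plane, h_t, h_s⟩ := FloatingPlanes.mainTheorem5_general
  exact ⟨π, hπ, fun h hh ε hε => (h_plane ε hε).imp fun _ hR => hR h hh,
    fun ε hε t s ht _ => (h_t ε hε).imp fun _ hR n => hR _ _ (ht n),
    fun t s ⟨C, hC⟩ => (h_s C).imp fun _ hR n => hR _ _ (hC n)⟩
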